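/- Let $n\ge 1$. A convex body in $\mathbb{R}^n$ is a compact convex set with non-empty interior; $V$ denotes volume, $\omega_n=V(B)$ the volume of the unit ball, $\sigma$ the (unnormalized) surface measure on $\mathbb{S}^{n-1}$, and $h_K(u)=\max_{x\in K}x\cdot u$ the support function of $K$ on $\mathbb{S}^{n-1}$. For a positive smooth function $\varphi$ on $\mathbb{S}^{n-1}$ and $p\in\mathbb{R}$, the identity $e_p^{\varphi}(K)=\vec{o}$ (the $\varphi$-weighted entropy point of $K$ is the origin) means that $\vec{o}\in\operatorname{int}K$ and \[\int_{\mathbb{S}^{n-1}}\frac{u}{\varphi(u)\,h_K(u)^{1-p}}\,d\sigma(u)=0;\] for $\varphi\equiv 1$ we write $e_p(K)=\vec{o}$. (1) Let $p>-n$, $p\neq 1$ and $0<a<\infty$. Let $S_{p,a}$ be the set of all convex bodies $K$ with $V(K)=\omega_n$, $e_p(K)=\vec{o}$ and \[\begin{cases}\int_{\mathbb{S}^{n-1}}h_K^p\,d\sigma\le a & \text{if } p>0,\\ \exp\left(\frac{1}{\omega_n}\int_{\mathbb{S}^{n-1}}-\log h_K\,d\sigma\right)\ge a & \text{if } p=0,\\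 \int_{\mathbb{S}^{n-1}}h_K^p\,d\sigma\ge a & \text{if } -n<p<0.\end{cases}\] Then there exist $0<r,R<\infty$, depending only on $n,p,a$, such that $r\le h_K\le R$ on $\mathbb{S}^{n-1}$ for every $K\in S_{p,a}$. (2) Let $\varphi$ be a positive smooth function on $\mathbb{S}^{n-1}$, $-n<p\le -n+1$ and $0<a<\infty$. Let $S_{\varphi,p,a}$ be the set of all convex bodies $K$ with $V(K)=\omega_n$, $e_p^{\varphi}(K)=\vec{o}$ and $\int_{\mathbb{S}^{n-1}}\frac{h_K^p}{\varphi}\,d\sigma\ge a$. Then there exist $0<r,R<\infty$, depending only on $n,p,a,\varphi$, such that $r\le h_K\le R$ on $\mathbb{S}^{n-1}$ for every $K\in S_{\varphi,p,a}$. (3) Let $\varphi$ be a positive smooth even function on $\mathbb{S}^{n-1}$ (that is, $\varphi(-u)=\varphi(u)$), $p>-n$ and $0<a<\infty$. Let $S_{e,\varphi,p,a}$ be the set of all origin-symmetric convex bodies $K$ with $V(K)=\omega_n$ and \[\begin{cases}\int_{\mathbb{S}^{n-1}}\frac{h_K^p}{\varphi}\,d\sigma\le a & \text{if } p>0,\\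 \exp\left(\frac{1}{\omega_n}\int_{\mathbb{S}^{n-1}}-\frac{\log h_K}{\varphi}\,d\sigma\right)\ge a & \text{if } p=0,\\ \int_{\mathbb{S}^{n-1}}\frac{h_K^p}{\varphi}\,d\sigma\ge a & \text{if } -n<p<0.\end{cases}\] Then there exist $0<r,R<\infty$, depending only on $n,p,a,\varphi$, such that $r\le h_K\le R$ on $\mathbb{S}^{n-1}$ for every $K\in S_{e,\varphi,p,a}$. -/

import Mathlib

open MeasureTheory Metric Set
open scoped Manifold ContDiff RealInnerProductSpace

/-- The Euclidean space of dimension `n`. -/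
abbrev E (n : ℕ) : Type := EuclideanSpace ℝ (Fin n)

/-- The unit sphere of the Euclidean space of dimension `n`. -/
abbrev S (n : ℕ) : Type := sphere (0 : E n) 1

/-- For `n ≠ 0` the sphere `S n` is a manifold of dimension `n - 1`, with Mathlib's structure. -/
instance factFinrankE (n : ℕ) [NeZero n] : Fact (Module.finrank ℝ (E n) = (n - 1) + 1) :=
  ⟨by
    rw [finrank_euclideanSpace_fin]
    exact (Nat.succ_pred_eq_of_ne_zero (NeZero.ne n)).symm⟩

noncomputable section

/-- The spherical Lebesgue (surface) measure on the unit sphere; it is not normalized. -/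
def sphereMeasure (n : ℕ) : Measure (S n) := (volume : Measure (E n)).toSphere

/-- The volume `ω_n` of the unit ball. -/
def unitBallVolume (n : ℕ) : ℝ := (volume : Measure (E n)).real (closedBall 0 1)

/-- The volume of a convex body. -/
def bodyVolume {n : ℕ} (K : ConvexBody (E n)) : ℝ := (volume : Measure (E n)).real (K : Set (E n))

/-- The support function `h_K(u) = max {x · u | x ∈ K}` on the unit sphere. -/
def supportFn {n : ℕ} (K : ConvexBody (E n)) (u : S n) : ℝ :=
  sSup ((fun x : E n => ⟪x, (u : E n)⟫) '' (K : Set (E n)))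

/-- The convex bodies with non-empty interior (Mathlib's `ConvexBody` allows empty interior). -/
def properBodies (n : ℕ) : Set (ConvexBody (E n)) :=
  {K | (interior (K : Set (E n))).Nonempty}

/-- The origin-symmetric convex bodies. -/
def symmetricBodies (n : ℕ) : Set (ConvexBody (E n)) :=
  {K | K ∈ properBodies n ∧ ∀ x ∈ K, -x ∈ K}

/-- The positive smooth functions on the unit sphere. -/
def positiveSmooth (n : ℕ) [NeZero n] : Set (S n → ℝ) :=
  {φ | (∀ u, 0 < φ u) ∧ ContMDiff (𝓡 (n - 1)) 𝓘(ℝ, ℝ) ∞ φ}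

/-- The positive smooth even functions on the unit sphere. -/
def positiveSmoothEven (n : ℕ) [NeZero n] : Set (S n → ℝ) :=
  {φ | φ ∈ positiveSmooth n ∧ ∀ u, φ (-u) = φ u}

/-- `e` is the entropy point of `K` with weight `φ` and exponent `p`: it lies in the interior of `K`
and `∫ u / (φ(u) (h_K(u) - e · u)^(1-p)) dσ(u) = 0`. -/
def IsEntropyPoint {n : ℕ} (φ : S n → ℝ) (p : ℝ) (K : ConvexBody (E n)) (e : E n) : Prop :=
  e ∈ interior (K : Set (E n)) ∧
    ∫ u : S n, (1 / (φ u * (supportFn K u - ⟪e, (u : E n)⟫) ^ (1 - p))) • (u : E n)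
      ∂(sphereMeasure n) = 0

/-- The bound on the entropy integral of `K` with weight `φ`: an upper bound on `∫ h_K^p / φ` for
positive `p`, a lower bound on it for negative `p`, and the logarithmic version for `p = 0`. -/
def EntropyBound {n : ℕ} (φ : S n → ℝ) (p a : ℝ) (K : ConvexBody (E n)) : Prop :=
  (0 < p → ∫ u, supportFn K u ^ p / φ u ∂(sphereMeasure n) ≤ a) ∧
  (p = 0 → a ≤ Real.exp
    ((1 / unitBallVolume n) * ∫ u, -(Real.log (supportFn K u) / φ u) ∂(sphereMeasure n))) ∧
  (p < 0 → a ≤ ∫ u, supportFn K u ^ p / φ u ∂(sphereMeasure n))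

/-- The entropy class `S_{p,a}` (weight identically `1`). -/
def entropyClass (n : ℕ) (p a : ℝ) : Set (ConvexBody (E n)) :=
  {K | K ∈ properBodies n ∧ bodyVolume K = unitBallVolume n ∧
    IsEntropyPoint (fun _ => 1) p K 0 ∧ EntropyBound (fun _ => 1) p a K}

/-- The weighted entropy class `S_{φ,p,a}`; it is meant for `-n < p ≤ -n + 1`. -/
def weightedEntropyClass (n : ℕ) (φ : S n → ℝ) (p a : ℝ) : Set (ConvexBody (E n)) :=
  {K | K ∈ properBodies n ∧ bodyVolume K = unitBallVolume n ∧
    IsEntropyPoint φ p K 0 ∧ a ≤ ∫ u, supportFn K u ^ p / φ u ∂(sphereMeasure n)}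

/-- The weighted entropy class `S_{e,φ,p,a}` of origin-symmetric bodies. -/
def symmetricEntropyClass (n : ℕ) (φ : S n → ℝ) (p a : ℝ) : Set (ConvexBody (E n)) :=
  {K | K ∈ symmetricBodies n ∧ bodyVolume K = unitBallVolume n ∧ EntropyBound φ p a K}

/-- The support functions of all members of `C` are pinched between two positive constants. -/
def UniformlyPinched {n : ℕ} (C : Set (ConvexBody (E n))) : Prop :=
  ∃ r R : ℝ, 0 < r ∧ 0 < R ∧ ∀ K ∈ C, ∀ u : S n, r ≤ supportFn K u ∧ supportFn K u ≤ R

end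

open scoped Pointwise

/-! ### Support functions -/

section Support
variable {n : ℕ}

/-! Upper bound. For `p > 0`, a far point of `K` makes `h_K` large on a whole cap, so the integral
bound suffices. For `p ≤ 0`, sandwich `K` between homothetic ellipsoids with centre `e`, so that
`h_K(u) - e · u` is comparable to `‖M u‖`; the volume bounds `|det M|` from below. For `-n < q < 0`
the integral of `‖M u‖ ^ q` tends to zero as `max ‖M u‖` grows (`exists_integral_norm_map_rpow_le`),
and the logarithm is compared with the power `-1/2`. The bound on `∫ h_K ^ p / φ` refers to the
origin and not to `e`. By convexity of `t ^ p` (concavity of `log`), the entropy condition makes the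
origin the extremal centre, so the bound passes to `e`; for symmetric `K` one averages over `u` and
`-u` instead.

Lower bound. Once `K` is bounded, its volume forces a ball of fixed radius `ρ` inside it
(`exists_inball`). A symmetric body thin in one direction lies in a slab of small volume. Otherwise
the entropy condition is used as a balance of moments. For `p < 1`, testing it against the centre of
the inball bounds `∫ h_K ^ (p - 1) / φ`. If `p - 1 ≤ -n`, this integral blows up when the Lipschitz
function `h_K` gets small, which settles the weighted class. For `φ = 1`, compare `u` with its
mirror image in the hyperplane orthogonal to a thin direction `v`. The cap around `v` gives a fixed
imbalance that must be compensated elsewhere. For `p > 1` nothing can compensate it. For `p < 1` and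
thinness `ε`, the compensation comes from directions where `h_K` is of order `ε`, and it costs a
fixed amount of `∫ h_K ^ (p - 1)`; doing this at many separated scales `ε` exceeds the bound on that
integral. At `p = 1` the condition with `φ = 1` carries no information on `K` beyond the position of
the origin in its interior. -/

theorem supportFn_isLUB (K : ConvexBody (E n)) (u : S n) :
    IsLUB ((fun x : E n => ⟪x, (u : E n)⟫) '' (K : Set (E n))) (supportFn K u) :=
  isLUB_csSup (K.nonempty.image _)
    (K.isCompact.image (by fun_prop)).bddAbove

theorem inner_le_supportFn (K : ConvexBody (E n)) (u : S n) {x : E n} (hx : x ∈ K) :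
    ⟪x, (u : E n)⟫ ≤ supportFn K u :=
  (supportFn_isLUB K u).1 ⟨x, hx, rfl⟩

theorem supportFn_le (K : ConvexBody (E n)) (u : S n) {a : ℝ}
    (h : ∀ x ∈ K, ⟪x, (u : E n)⟫ ≤ a) : supportFn K u ≤ a :=
  (supportFn_isLUB K u).2 (by rintro _ ⟨x, hx, rfl⟩; exact h x hx)

theorem exists_inner_eq_supportFn (K : ConvexBody (E n)) (u : S n) :
    ∃ x ∈ K, ⟪x, (u : E n)⟫ = supportFn K u :=
  (K.isCompact.image (f := fun x : E n => ⟪x, (u : E n)⟫) (by fun_prop)).sSup_mem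
    (K.nonempty.image _)

theorem supportFn_le_add_mul_norm {K : ConvexBody (E n)} {R : ℝ} (hR : ∀ x ∈ K, ‖x‖ ≤ R)
    (u v : S n) : supportFn K u ≤ supportFn K v + R * ‖(u : E n) - v‖ := by
  refine supportFn_le K u fun x hx => ?_
  have h1 := inner_le_supportFn K v hx
  have h2 : ⟪x, (u : E n)⟫ = ⟪x, (v : E n)⟫ + ⟪x, (u : E n) - v⟫ := by rw [inner_sub_right]; ring
  have h3 := (real_inner_le_norm x ((u : E n) - v)).trans
    (mul_le_mul_of_nonneg_right (hR x hx) (norm_nonneg _))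
  linarith

theorem continuous_supportFn (K : ConvexBody (E n)) : Continuous (supportFn K) := by
  obtain ⟨R, hR⟩ := K.isCompact.isBounded.exists_norm_le
  have : LipschitzWith R.toNNReal (supportFn K) := by
    refine LipschitzWith.of_le_add_mul _ fun u v => ?_
    have h := supportFn_le_add_mul_norm hR u v
    refine h.trans ?_
    rw [Subtype.dist_eq, dist_eq_norm]
    gcongr
    exact Real.le_coe_toNNReal R
  exact this.continuous

theorem norm_sphere_coe (u : S n) : ‖(u : E n)‖ = 1 := norm_eq_of_mem_sphere u

/-- The direction of a nonzero vector. -/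
noncomputable def direction (x : E n) (hx : x ≠ 0) : S n :=
  ⟨‖x‖⁻¹ • x, by simp [norm_smul, hx]⟩

theorem inner_direction_self (x : E n) (hx : x ≠ 0) : ⟪x, (direction x hx : E n)⟫ = ‖x‖ := by
  have : ‖x‖ ≠ 0 := norm_ne_zero_iff.2 hx
  simp only [direction, inner_smul_right, real_inner_self_eq_norm_sq]
  field_simp

theorem norm_le_of_supportFn_le {K : ConvexBody (E n)} {R : ℝ} (hR0 : 0 ≤ R)
    (hR : ∀ u, supportFn K u ≤ R) {x : E n} (hx : x ∈ K) : ‖x‖ ≤ R := by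
  by_cases h0 : x = 0
  · simpa [h0] using hR0
  · rw [← inner_direction_self x h0]
    exact (inner_le_supportFn K _ hx).trans (hR _)

theorem inner_add_le_supportFn_of_ball_subset {K : ConvexBody (E n)} {e : E n} {ρ : ℝ} (hρ : 0 ≤ ρ)
    (h : closedBall e ρ ⊆ (K : Set (E n))) (u : S n) : ⟪e, (u : E n)⟫ + ρ ≤ supportFn K u := by
  have : e + ρ • (u : E n) ∈ K := h (by simp [norm_smul, abs_of_nonneg hρ])
  have h1 := inner_le_supportFn K u this
  rwa [inner_add_left, real_inner_smul_left, real_inner_self_eq_norm_sq, norm_sphere_coe,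
    one_pow, mul_one] at h1

theorem exists_add_le_supportFn {K : ConvexBody (E n)} {e : E n}
    (he : e ∈ interior (K : Set (E n))) :
    ∃ ρ > 0, ∀ u : S n, ⟪e, (u : E n)⟫ + ρ ≤ supportFn K u := by
  obtain ⟨ρ, hρ, h⟩ := nhds_basis_closedBall.mem_iff.1 (mem_interior_iff_mem_nhds.1 he)
  exact ⟨ρ, hρ, inner_add_le_supportFn_of_ball_subset hρ.le h⟩

theorem supportFn_pos {K : ConvexBody (E n)} (h0 : (0 : E n) ∈ interior (K : Set (E n)))
    (u : S n) : 0 < supportFn K u := by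
  obtain ⟨ρ, hρ, h⟩ := exists_add_le_supportFn h0
  have := h u
  simp at this
  linarith

theorem zero_mem_interior_of_symmetric {K : ConvexBody (E n)} (hK : K ∈ symmetricBodies n) :
    (0 : E n) ∈ interior (K : Set (E n)) := by
  obtain ⟨⟨e, he⟩, hs⟩ := hK
  obtain ⟨ρ, hρ, h⟩ := nhds_basis_closedBall.mem_iff.1 (mem_interior_iff_mem_nhds.1 he)
  refine mem_interior_iff_mem_nhds.2 (Filter.mem_of_superset (closedBall_mem_nhds 0 hρ) ?_)
  intro x hx
  have h1 : e + x ∈ K := h (by simpa using hx)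
  have h2 : -e ∈ K := hs _ (interior_subset he)
  have h3 : -(e - x) ∈ K := hs _ (h (by simpa using hx))
  have := K.convex h1 h3 (a := 1/2) (b := 1/2) (by norm_num) (by norm_num) (by norm_num)
  convert this using 1
  module

theorem supportFn_neg_of_symmetric {K : ConvexBody (E n)} (hs : ∀ x ∈ K, -x ∈ K) (u : S n) :
    supportFn K (-u) = supportFn K u := by
  refine le_antisymm (supportFn_le K _ fun x hx => ?_) (supportFn_le K _ fun x hx => ?_)
  · have := inner_le_supportFn K u (hs x hx)
    simpa using this
  · have := inner_le_supportFn K (-u) (hs x hx)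
    simpa using this

end Support

/-! ### Surface measure and its invariance under isometries -/

section SphereMeasure
variable {n : ℕ}

instance isFiniteMeasure_sphereMeasure : IsFiniteMeasure (sphereMeasure n) := by
  unfold sphereMeasure; infer_instance

instance isOpenPosMeasure_sphereMeasure : (sphereMeasure n).IsOpenPosMeasure := by
  unfold sphereMeasure; infer_instance

theorem Continuous.integrable_sphereMeasure {f : S n → ℝ} (hf : Continuous f) :
    Integrable f (sphereMeasure n) :=
  integrableOn_univ.1 (hf.continuousOn.integrableOn_compact isCompact_univ)

theorem sphereMeasure_apply {s : Set (S n)} (hs : MeasurableSet s) :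
    sphereMeasure n s = n * volume (Ioo (0 : ℝ) 1 • ((↑) '' s : Set (E n))) := by
  rw [sphereMeasure, Measure.toSphere_apply' _ hs, finrank_euclideanSpace_fin]

/-- The action of a linear isometry on the unit sphere. -/
noncomputable def LinearIsometryEquiv.sphereMap (L : E n ≃ₗᵢ[ℝ] E n) (u : S n) : S n :=
  ⟨L u, by simp⟩

theorem LinearIsometryEquiv.continuous_sphereMap (L : E n ≃ₗᵢ[ℝ] E n) :
    Continuous L.sphereMap :=
  Continuous.subtype_mk (L.continuous.comp continuous_subtype_val) _

/-- The surface measure of a set is `n` times the volume of the cone over it, and isometries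
preserve such volumes. -/
theorem LinearIsometryEquiv.measurePreserving_sphereMap (L : E n ≃ₗᵢ[ℝ] E n) :
    MeasurePreserving L.sphereMap (sphereMeasure n) (sphereMeasure n) := by
  refine ⟨L.continuous_sphereMap.measurable, ?_⟩
  ext s hs
  rw [Measure.map_apply L.continuous_sphereMap.measurable hs, sphereMeasure_apply hs,
    sphereMeasure_apply (L.continuous_sphereMap.measurable hs)]
  congr 1
  rw [← (L.measurePreserving.measure_preimage_emb L.toHomeomorph.measurableEmbedding
    (Ioo (0 : ℝ) 1 • ((↑) '' s : Set (E n))))]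
  congr 1
  ext x
  simp only [Set.mem_smul, Set.mem_image, Set.mem_preimage, Subtype.exists, exists_and_right,
    exists_eq_right]
  constructor
  · rintro ⟨r, hr, y, ⟨hy, hys⟩, rfl⟩
    exact ⟨r, hr, L y, ⟨by simpa using hy, hys⟩, by simp⟩
  · rintro ⟨r, hr, y, ⟨hy, hys⟩, h⟩
    refine ⟨r, hr, L.symm y, ⟨by simpa using hy, ?_⟩, ?_⟩
    · simpa [LinearIsometryEquiv.sphereMap] using hys
    · apply L.injective
      simpa using h

theorem LinearIsometryEquiv.integral_sphereMap (L : E n ≃ₗᵢ[ℝ] E n) {f : S n → ℝ}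
    (hf : Continuous f) :
    ∫ u, f (L.sphereMap u) ∂(sphereMeasure n) = ∫ u, f u ∂(sphereMeasure n) := by
  have h := L.measurePreserving_sphereMap (n := n)
  have h1 := integral_map (μ := sphereMeasure n) h.measurable.aemeasurable (f := f)
    hf.aestronglyMeasurable
  rw [h.map_eq] at h1
  exact h1.symm

end SphereMeasure

/-! ### Volumes of slabs and measures of caps -/

section Volume
variable {n : ℕ}

instance nonempty_sphere [NeZero n] : Nonempty (S n) :=
  ⟨⟨EuclideanSpace.single 0 1, by simp⟩⟩

theorem exists_linearIsometryEquiv_apply_eq (v w : S n) :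
    ∃ L : E n ≃ₗᵢ[ℝ] E n, L v = w :=
  ⟨_, Submodule.reflection_sub (by simp)⟩

theorem unitBallVolume_pos : 0 < unitBallVolume n :=
  ENNReal.toReal_pos (measure_closedBall_pos volume _ one_pos).ne' measure_closedBall_lt_top.ne

/-- For one direction the slabs decrease to a piece of a hyperplane, a null set; an isometry carries
that direction to any other, so the width is uniform. -/
theorem exists_slab_volume_lt [NeZero n] (R : ℝ) {η : ENNReal} (hη : 0 < η) :
    ∃ t > 0, ∀ w : S n, volume {x : E n | ‖x‖ ≤ R ∧ |⟪x, (w : E n)⟫| ≤ t} < η := by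
  obtain ⟨w₀⟩ := nonempty_sphere (n := n)
  let s : ℕ → Set (E n) := fun k => {x : E n | ‖x‖ ≤ R ∧ |⟪x, (w₀ : E n)⟫| ≤ 1 / ((k : ℝ) + 1)}
  have hclosed : ∀ k, IsClosed (s k) := fun k =>
    (isClosed_le continuous_norm continuous_const).inter
      (isClosed_le (f := fun x : E n => |⟪x, (w₀ : E n)⟫|) (by fun_prop) continuous_const)
  have hnull : volume (⋂ k, s k) = 0 := by
    refine measure_mono_null ?_ (Measure.addHaar_submodule volume (ℝ ∙ (w₀ : E n))ᗮ ?_)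
    · intro x hx
      rw [SetLike.mem_coe, Submodule.mem_orthogonal_singleton_iff_inner_left]
      by_contra h
      obtain ⟨k, hk⟩ := exists_nat_one_div_lt (abs_pos.2 h)
      exact absurd (mem_iInter.1 hx k).2 (not_le.2 hk)
    · intro h
      have : (w₀ : E n) ∈ (ℝ ∙ (w₀ : E n))ᗮ := h ▸ Submodule.mem_top
      rw [Submodule.mem_orthogonal_singleton_iff_inner_left, real_inner_self_eq_norm_sq,
        norm_sphere_coe] at this
      norm_num at this
  have htend := tendsto_measure_iInter_atTop (μ := volume) (s := s)
    (fun k => (hclosed k).measurableSet.nullMeasurableSet)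
    (fun i j hij x hx => ⟨hx.1, hx.2.trans (Nat.one_div_le_one_div hij)⟩)
    ⟨0, ((measure_mono (fun x hx => by simpa using hx.1)).trans_lt
      (measure_closedBall_lt_top (x := (0 : E n)) (r := R))).ne⟩
  rw [hnull] at htend
  obtain ⟨k, hk⟩ := (htend.eventually (gt_mem_nhds hη)).exists
  refine ⟨1 / ((k : ℝ) + 1), by positivity, fun w => ?_⟩
  obtain ⟨L, hL⟩ := exists_linearIsometryEquiv_apply_eq w₀ w
  rw [← L.measurePreserving.measure_preimage_emb L.toHomeomorph.measurableEmbedding]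
  refine (measure_mono fun x hx => ?_).trans_lt hk
  simpa [s, ← hL] using hx

theorem ball_subset_Ioo_smul_ball (v : S n) {δ : ℝ} (hδ1 : δ ≤ 1) :
    ball ((1 - δ / 4) • (v : E n)) (δ / 4) ⊆ Ioo (0 : ℝ) 1 • ((↑) '' ball v δ : Set (E n)) := by
  intro y hy
  rw [mem_ball, dist_eq_norm] at hy
  have hv := norm_sphere_coe v
  have h1 : ‖(1 - δ / 4) • (v : E n)‖ = 1 - δ / 4 := by
    rw [norm_smul, hv, mul_one, Real.norm_of_nonneg (by linarith)]
  have h2 : ‖y‖ < 1 := by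
    have := norm_le_insert' y ((1 - δ / 4) • (v : E n))
    linarith
  have h3 : 1 - δ / 2 < ‖y‖ := by
    have := norm_le_insert y ((1 - δ / 4) • (v : E n))
    linarith
  have hy0 : y ≠ 0 := norm_pos_iff.1 (by linarith)
  refine ⟨‖y‖, ⟨by linarith, h2⟩, direction y hy0, ⟨_, ?_, rfl⟩, ?_⟩
  · rw [mem_ball, Subtype.dist_eq, dist_eq_norm]
    have h4 : ‖(direction y hy0 : E n) - y‖ = 1 - ‖y‖ := by
      have : (direction y hy0 : E n) - y = (‖y‖⁻¹ - 1) • y := by simp [direction, sub_smul]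
      rw [this, norm_smul, Real.norm_of_nonneg, sub_mul, inv_mul_cancel₀ (by linarith), one_mul]
      rw [sub_nonneg, one_le_inv₀ (by linarith)]
      exact h2.le
    have h5 : ‖(1 - δ / 4) • (v : E n) - v‖ = δ / 4 := by
      have : (1 - δ / 4) • (v : E n) - v = (-(δ / 4)) • (v : E n) := by module
      rw [this, norm_smul, hv, norm_neg, Real.norm_of_nonneg (by linarith), mul_one]
    have h6 : (direction y hy0 : E n) - v = ((direction y hy0 : E n) - y) +
      (y - (1 - δ / 4) • (v : E n)) + ((1 - δ / 4) • (v : E n) - v) := by abel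
    rw [h6]
    have := norm_add₃_le (a := (direction y hy0 : E n) - y) (b := y - (1 - δ / 4) • (v : E n))
      (c := (1 - δ / 4) • (v : E n) - v)
    linarith
  · have : ‖y‖ ≠ 0 := norm_ne_zero_iff.2 hy0
    simp [direction, smul_smul, this]

/-- A spherical cap of radius `δ` has measure at least of the order `δ ^ (n - 1)`. -/
theorem le_sphereMeasure_ball (v : S n) {δ : ℝ} (hδ : 0 < δ) (hδ1 : δ ≤ 1) :
    2 * (δ / 4) ^ n * unitBallVolume n ≤ δ * (sphereMeasure n).real (ball v δ) := by
  -- The cone `T` over the cap contains both `(1 - δ/2) T` and a disjoint ball of radius `δ/4` near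
  -- its outer end. Bernoulli's inequality bounds the volume lost in the scaling by `n (δ/2) V(T)`,
  -- so the ball has at most this volume.
  set T : Set (E n) := Ioo (0 : ℝ) 1 • ((↑) '' ball v δ : Set (E n))
  have hT1 : T ⊆ ball 0 1 := by
    rintro _ ⟨r, hr, _, ⟨u, -, rfl⟩, rfl⟩
    simp [norm_smul, abs_of_pos hr.1, hr.2]
  have hTfin : volume T ≠ ⊤ := ((measure_mono hT1).trans_lt measure_ball_lt_top).ne
  have hsub : (1 - δ / 2) • T ⊆ T := by
    rintro _ ⟨_, ⟨r, hr, u, hu, rfl⟩, rfl⟩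
    refine ⟨(1 - δ / 2) * r, ⟨by nlinarith [hr.1], by nlinarith [hr.1, hr.2]⟩, u, hu, ?_⟩
    simp [mul_smul]
  have hdisj : Disjoint ((1 - δ / 2) • T) (ball ((1 - δ / 4) • (v : E n)) (δ / 4)) := by
    rw [Set.disjoint_left]
    rintro _ ⟨x, hx, rfl⟩ hy
    have h1 : ‖x‖ < 1 := by simpa using hT1 hx
    rw [mem_ball, dist_eq_norm] at hy
    have h2 := norm_le_insert ((1 - δ / 2) • x) ((1 - δ / 4) • (v : E n))
    rw [norm_smul, norm_smul, norm_sphere_coe, Real.norm_of_nonneg (by linarith),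
      Real.norm_of_nonneg (by linarith)] at h2
    nlinarith
  have hmeas : volume.real (ball ((1 - δ / 4) • (v : E n)) (δ / 4)) =
      (δ / 4) ^ n * unitBallVolume n := by
    rw [measureReal_def, Measure.addHaar_ball_of_pos _ _ (by positivity), unitBallVolume,
      measureReal_def, Measure.addHaar_unitClosedBall_eq_addHaar_unitBall, ENNReal.toReal_mul,
      finrank_euclideanSpace_fin, ENNReal.toReal_ofReal (by positivity)]
  have hscale : volume.real ((1 - δ / 2) • T) = (1 - δ / 2) ^ n * volume.real T := by
    rw [measureReal_def, Measure.addHaar_smul, ENNReal.toReal_mul, finrank_euclideanSpace_fin,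
      ENNReal.toReal_ofReal (by positivity), abs_of_nonneg (pow_nonneg (by linarith) _),
      measureReal_def]
  have hunion := measureReal_union (μ := volume) hdisj measurableSet_ball
    (measure_ne_top_of_subset hsub hTfin) measure_ball_lt_top.ne
  have hle := measureReal_mono (μ := volume)
    (union_subset hsub (ball_subset_Ioo_smul_ball v hδ1)) hTfin
  have hbern : 1 - n * (δ / 2) ≤ (1 - δ / 2) ^ n := by
    have := one_add_mul_le_pow (a := -(δ / 2)) (by linarith) n
    simpa [sub_eq_add_neg] using this
  have hσ : (sphereMeasure n).real (ball v δ) = n * volume.real T := by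
    rw [measureReal_def, sphereMeasure_apply measurableSet_ball, ENNReal.toReal_mul]
    rfl
  have hT0 : 0 ≤ volume.real T := measureReal_nonneg
  rw [hunion, hmeas, hscale] at hle
  rw [hσ]
  nlinarith [mul_le_mul_of_nonneg_right hbern hT0]

theorem exists_le_sphereMeasure_ball {δ : ℝ} (hδ : 0 < δ) :
    ∃ κ > 0, ∀ v : S n, κ ≤ (sphereMeasure n).real (ball v δ) := by
  refine ⟨2 * (min δ 1 / 4) ^ n * unitBallVolume n / min δ 1, ?_, fun v => ?_⟩
  · have := unitBallVolume_pos (n := n)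
    have : (0 : ℝ) < min δ 1 := lt_min hδ one_pos
    positivity
  · rw [div_le_iff₀ (lt_min hδ one_pos), mul_comm ((sphereMeasure n).real (ball v δ))]
    refine (le_sphereMeasure_ball v (lt_min hδ one_pos) (min_le_right _ _)).trans ?_
    exact mul_le_mul_of_nonneg_left (measureReal_mono (ball_subset_ball (min_le_left δ 1)))
      (lt_min hδ one_pos).le

end Volume

/-! ### Decay of negative moments of elongated ellipsoids -/

section Decay
variable {n : ℕ}

/-- Polar coordinates: the left side is the volume of the star-shaped set with radial function `g`,
up to the origin and the boundary. -/
theorem lintegral_rpow_radial_le (g : S n → ℝ) (hg : Measurable g) (hg0 : ∀ u, 0 < g u) [NeZero n]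
    {A : Set (E n)} (hA : ∀ u : S n, ∀ r : ℝ, 0 < r → r < g u → r • (u : E n) ∈ A) :
    ∫⁻ u, ENNReal.ofReal (g u ^ n / n) ∂(sphereMeasure n) ≤ volume A := by
  have hn : n - 1 + 1 = n := Nat.succ_pred_eq_of_ne_zero (NeZero.ne n)
  have hmp := (volume : Measure (E n)).measurePreserving_homeomorphUnitSphereProd
  let B : Set (S n × Ioi (0 : ℝ)) := {p | (p.2 : ℝ) < g p.1}
  have hB : MeasurableSet B := measurableSet_lt (by fun_prop) (by fun_prop)
  have h1 := hmp.measure_preimage hB.nullMeasurableSet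
  rw [Measure.prod_apply hB, comap_subtype_coe_apply (measurableSet_singleton _).compl] at h1
  have h2 : ∀ u : S n, Measure.volumeIoiPow (Module.finrank ℝ (E n) - 1) (Prod.mk u ⁻¹' B) =
      ENNReal.ofReal (g u ^ n / n) := by
    intro u
    have : Prod.mk u ⁻¹' B = Iio (⟨g u, hg0 u⟩ : Ioi (0 : ℝ)) := by
      ext r; rfl
    rw [this, Measure.volumeIoiPow_apply_Iio, finrank_euclideanSpace_fin, hn]
    congr 2
    exact_mod_cast hn
  simp only [h2] at h1
  rw [sphereMeasure, ← h1]
  refine measure_mono ?_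
  rintro _ ⟨x, hx, rfl⟩
  have hx' := hA (homeomorphUnitSphereProd (E n) x).1 _ (homeomorphUnitSphereProd (E n) x).2.2 hx
  have h3 : (x : E n) = ((homeomorphUnitSphereProd (E n) x).2 : ℝ) •
      ((homeomorphUnitSphereProd (E n) x).1 : E n) := by
    rw [← homeomorphUnitSphereProd_symm_apply_coe, Homeomorph.symm_apply_apply]
  rwa [h3]

theorem map_sphere_ne_zero {M : E n →ₗ[ℝ] E n} (hM : LinearMap.det M ≠ 0) (u : S n) :
    M u ≠ 0 := by
  intro h
  have h1 : (u : E n) = 0 := (M.equivOfDetNeZero hM).injective (by simpa using h)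
  have := norm_sphere_coe u
  simp [h1] at this

theorem continuous_norm_map (M : E n →ₗ[ℝ] E n) : Continuous fun u : S n => ‖M u‖ :=
  (M.continuous_of_finiteDimensional.comp continuous_subtype_val).norm

theorem continuous_norm_map_rpow {M : E n →ₗ[ℝ] E n} (hM : LinearMap.det M ≠ 0) (q : ℝ) :
    Continuous fun u : S n => ‖M u‖ ^ q :=
  (continuous_norm_map M).rpow_const fun u =>
    Or.inl (norm_ne_zero_iff.2 (map_sphere_ne_zero hM u))

/-- The function `1 / ‖M u‖` is the radial function of the ellipsoid that `M` maps onto the unit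
ball; its volume is `ω_n / |det M|`. -/
theorem integral_norm_map_rpow_neg_le [NeZero n] {M : E n →ₗ[ℝ] E n} (hM : LinearMap.det M ≠ 0) :
    ∫ u : S n, ‖M u‖ ^ (-(n : ℝ)) ∂(sphereMeasure n) ≤
      n * unitBallVolume n / |LinearMap.det M| := by
  have hn : (n : ℝ) ≠ 0 := Nat.cast_ne_zero.2 (NeZero.ne n)
  have hpos : ∀ u : S n, 0 < ‖M u‖ := fun u => norm_pos_iff.2 (map_sphere_ne_zero hM u)
  have h1 := lintegral_rpow_radial_le (n := n) (fun u => ‖M u‖⁻¹)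
    (continuous_norm_map M).measurable.inv (fun u => inv_pos.2 (hpos u))
    (A := M ⁻¹' closedBall 0 1) (fun u r hr hru => by
      rw [lt_inv_comm₀ hr (hpos u)] at hru
      have : r * ‖M u‖ ≤ r * r⁻¹ := mul_le_mul_of_nonneg_left hru.le hr.le
      rw [mul_inv_cancel₀ hr.ne'] at this
      simpa [norm_smul, abs_of_pos hr] using this)
  rw [Measure.addHaar_preimage_linearMap _ hM] at h1
  have h2 : ∀ u : S n, ‖M u‖⁻¹ ^ n / n = ‖M u‖ ^ (-(n : ℝ)) / n := fun u => by
    rw [Real.rpow_neg (norm_nonneg _), Real.rpow_natCast, inv_pow]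
  simp only [h2] at h1
  rw [← ofReal_integral_eq_lintegral_ofReal
    ((continuous_norm_map_rpow hM _).div_const _).integrable_sphereMeasure
    (ae_of_all _ fun u => by positivity)] at h1
  have h3 : ENNReal.ofReal |(LinearMap.det M)⁻¹| * volume (closedBall (0 : E n) 1) =
      ENNReal.ofReal (|LinearMap.det M|⁻¹ * unitBallVolume n) := by
    rw [ENNReal.ofReal_mul (by positivity), abs_inv, unitBallVolume,
      ofReal_measureReal measure_closedBall_lt_top.ne]
  rw [h3, ENNReal.ofReal_le_ofReal_iff (by have := unitBallVolume_pos (n := n); positivity),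
    integral_div, div_le_iff₀ (by positivity)] at h1
  calc _ ≤ _ := h1
    _ = _ := by ring

/-- Take `w` along `z = M* M u₀`: then `x · z = M x · M u₀`, while `‖z‖ ≥ z · u₀ = ‖M u₀‖ ^ 2`. -/
theorem inner_direction_map_le (M : E n →ₗ[ℝ] E n) {u₀ : S n} {t B : ℝ} (hB : 0 < B) (ht : 0 ≤ t)
    (h0 : B ≤ ‖M u₀‖) :
    ∃ w : S n, ∀ x : E n, ‖M x‖ ≤ t * B → |⟪x, (w : E n)⟫| ≤ t := by
  set z := LinearMap.adjoint M (M u₀)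
  have h1 : ⟪z, (u₀ : E n)⟫ = ‖M u₀‖ ^ 2 := by
    rw [LinearMap.adjoint_inner_left, real_inner_self_eq_norm_sq]
  have h2 : ‖M u₀‖ ^ 2 ≤ ‖z‖ := by
    have := real_inner_le_norm z (u₀ : E n)
    rwa [h1, norm_sphere_coe, mul_one] at this
  have hz : z ≠ 0 := norm_pos_iff.1 (lt_of_lt_of_le (by positivity [hB.trans_le h0]) h2)
  refine ⟨direction z hz, fun x hx => ?_⟩
  have h3 : |⟪x, z⟫| ≤ t * ‖z‖ := by
    rw [LinearMap.adjoint_inner_right]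
    calc |⟪M x, M u₀⟫| ≤ ‖M x‖ * ‖M u₀‖ := abs_real_inner_le_norm _ _
      _ ≤ (t * B) * ‖M u₀‖ := by gcongr
      _ ≤ (t * ‖M u₀‖) * ‖M u₀‖ := by gcongr
      _ = t * ‖M u₀‖ ^ 2 := by ring
      _ ≤ t * ‖z‖ := by gcongr
  simp only [direction, inner_smul_right, abs_mul, abs_inv, abs_norm]
  rw [inv_mul_le_iff₀ (norm_pos_iff.2 hz), mul_comm]
  exact h3

theorem sphereMeasure_norm_map_le_le (M : E n →ₗ[ℝ] E n) {s : ℝ} :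
    sphereMeasure n {u | ‖M u‖ ≤ s} ≤ n * volume {x : E n | ‖x‖ ≤ 1 ∧ ‖M x‖ ≤ s} := by
  rw [sphereMeasure_apply (isClosed_le (continuous_norm_map M) continuous_const).measurableSet]
  gcongr
  rintro _ ⟨r, hr, _, ⟨u, hu, rfl⟩, rfl⟩
  rw [mem_ofPred_eq] at hu
  have h0 := norm_nonneg (M u)
  simp only [mem_ofPred_eq, norm_smul, map_smul, norm_sphere_coe, Real.norm_of_nonneg hr.1.le]
  constructor
  · linarith [hr.2]
  · nlinarith [hr.1, hr.2]

/-- The sphere is split by the size of `‖M u‖`. Below `ε` the integrand is at most `ε ^ (n + q) ‖M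
u‖ ^ (-n)`, whose integral is controlled by the determinant; above `s` it is at most `s ^ q`; in
between it is at most `ε ^ q` on a set that lies in a thin slab once `M` is large in some direction.
-/
theorem exists_integral_norm_map_rpow_le [NeZero n] {q c δ : ℝ} (hqn : -(n : ℝ) < q) (hq : q < 0)
    (hc : 0 < c) (hδ : 0 < δ) :
    ∃ B > 0, ∀ M : E n →ₗ[ℝ] E n, c ≤ |LinearMap.det M| → ∀ u₀ : S n, B ≤ ‖M u₀‖ →
      ∫ u : S n, ‖M u‖ ^ q ∂(sphereMeasure n) ≤ δ := by
  have hω := unitBallVolume_pos (n := n)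
  have hn : (0 : ℝ) < n := Nat.cast_pos.2 (NeZero.pos n)
  have hnq : 0 < n + q := by linarith
  set σ := sphereMeasure n
  -- the radius below which the integrand is compared with the power `-n`
  obtain ⟨ε, hε, hε1⟩ : ∃ ε > 0, ε ^ (n + q) * (n * unitBallVolume n / c) ≤ δ / 3 := by
    refine ⟨(δ / 3 / (n * unitBallVolume n / c)) ^ (n + q)⁻¹, by positivity, ?_⟩
    rw [← Real.rpow_mul (by positivity), inv_mul_cancel₀ hnq.ne', Real.rpow_one,
      div_mul_cancel₀ _ (by positivity)]
  obtain ⟨s, hs, hs1⟩ : ∃ s > 0, s ^ q * σ.real univ ≤ δ / 3 := by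
    have h := (tendsto_rpow_neg_atTop (neg_pos.2 hq)).mul_const (σ.real univ)
    rw [neg_neg, zero_mul] at h
    obtain ⟨s, hs, hs'⟩ := ((h.eventually (ge_mem_nhds (show 0 < δ / 3 by positivity))).and
      (Filter.eventually_gt_atTop 0)).exists
    exact ⟨s, hs', hs⟩
  obtain ⟨t, ht, ht1⟩ := exists_slab_volume_lt (n := n) 1
    (η := ENNReal.ofReal (δ / (3 * ε ^ q * n))) (by positivity)
  -- With this bound on `‖M u₀‖`, the set `‖M u‖ ≤ s` lies in a slab of half-width `t`.
  refine ⟨s / t, by positivity, fun M hM u₀ hu₀ => ?_⟩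
  have hdet : LinearMap.det M ≠ 0 := abs_pos.1 (hc.trans_le hM)
  have hsmall : ε ^ q * σ.real {u | ‖M u‖ ≤ s} ≤ δ / 3 := by
    obtain ⟨w, hw⟩ := inner_direction_map_le M (by positivity) ht.le hu₀
    rw [mul_div_cancel₀ _ ht.ne'] at hw
    have h1 : σ {u | ‖M u‖ ≤ s} ≤ n * ENNReal.ofReal (δ / (3 * ε ^ q * n)) := by
      refine (sphereMeasure_norm_map_le_le M).trans ?_
      gcongr
      refine (measure_mono ?_).trans (ht1 w).le
      exact fun x hx => ⟨hx.1, hw x hx.2⟩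
    have h2 := ENNReal.toReal_mono (by finiteness) h1
    rw [ENNReal.toReal_mul, ENNReal.toReal_ofReal (by positivity), ENNReal.toReal_natCast] at h2
    calc ε ^ q * σ.real {u | ‖M u‖ ≤ s} ≤ ε ^ q * (n * (δ / (3 * ε ^ q * n))) := by
          gcongr; exact h2
      _ = δ / 3 := by
        have : ε ^ q ≠ 0 := by positivity
        field_simp
  have hmeas : MeasurableSet {u : S n | ‖M u‖ ≤ s} :=
    (isClosed_le (continuous_norm_map M) continuous_const).measurableSet
  have hint1 := ((continuous_norm_map_rpow hdet (-(n : ℝ))).const_mul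
    (ε ^ (n + q))).integrable_sphereMeasure
  have hint2 : Integrable ({u : S n | ‖M u‖ ≤ s}.indicator fun _ => ε ^ q) σ :=
    (integrable_const _).indicator hmeas
  have hint3 : Integrable (fun _ : S n => s ^ q) σ := integrable_const _
  have hint12 : Integrable (fun u : S n => ε ^ (n + q) * ‖M u‖ ^ (-(n : ℝ)) +
      {u : S n | ‖M u‖ ≤ s}.indicator (fun _ => ε ^ q) u) σ := hint1.add hint2
  have hle : ∀ u : S n, ‖M u‖ ^ q ≤ ε ^ (n + q) * ‖M u‖ ^ (-(n : ℝ)) +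
      {u : S n | ‖M u‖ ≤ s}.indicator (fun _ => ε ^ q) u + s ^ q := by
    intro u
    have hpos : 0 < ‖M u‖ := norm_pos_iff.2 (map_sphere_ne_zero hdet u)
    have ha : 0 ≤ ε ^ (n + q) * ‖M u‖ ^ (-(n : ℝ)) := by positivity
    have hb : 0 ≤ {u : S n | ‖M u‖ ≤ s}.indicator (fun _ => ε ^ q) u :=
      indicator_nonneg (fun _ _ => by positivity) u
    have hc' : 0 ≤ s ^ q := by positivity
    rcases le_total ‖M u‖ ε with h | h
    · have : ‖M u‖ ^ q ≤ ε ^ (n + q) * ‖M u‖ ^ (-(n : ℝ)) := by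
        calc ‖M u‖ ^ q = ‖M u‖ ^ (n + q) * ‖M u‖ ^ (-(n : ℝ)) := by
              rw [← Real.rpow_add hpos]; congr 1; ring
          _ ≤ _ := by gcongr
      linarith
    · rcases le_total ‖M u‖ s with h' | h'
      · rw [indicator_of_mem (by exact h')] at hb ⊢
        have := Real.rpow_le_rpow_of_nonpos hε h hq.le
        linarith
      · have := Real.rpow_le_rpow_of_nonpos hs h' hq.le
        linarith
  calc ∫ u : S n, ‖M u‖ ^ q ∂σ ≤ ∫ u : S n, (ε ^ (n + q) * ‖M u‖ ^ (-(n : ℝ)) +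
      {u : S n | ‖M u‖ ≤ s}.indicator (fun _ => ε ^ q) u + s ^ q) ∂σ :=
        integral_mono (continuous_norm_map_rpow hdet q).integrable_sphereMeasure
          (hint12.add hint3) hle
    _ = ε ^ (n + q) * ∫ u : S n, ‖M u‖ ^ (-(n : ℝ)) ∂σ + ε ^ q * σ.real {u | ‖M u‖ ≤ s}
        + s ^ q * σ.real univ := by
      rw [integral_add hint12 hint3, integral_add hint1 hint2, integral_const_mul,
        integral_indicator_const _ hmeas, integral_const, smul_eq_mul, smul_eq_mul]
      ring
    _ ≤ δ / 3 + δ / 3 + δ / 3 := by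
      gcongr
      refine le_trans ?_ hε1
      gcongr
      refine (integral_norm_map_rpow_neg_le hdet).trans ?_
      gcongr
    _ = δ := by ring

end Decay

/-! ### Ellipsoids from a simplex of maximal volume -/

section MaximalSimplex
variable {n : ℕ}

theorem abs_det_adjoint (A : E n →ₗ[ℝ] E n) :
    |LinearMap.det (LinearMap.adjoint A)| = |LinearMap.det A| := by
  have b := EuclideanSpace.basisFun (Fin n) ℝ
  rw [← LinearMap.det_toMatrix b.toBasis, ← LinearMap.det_toMatrix b.toBasis,
    LinearMap.toMatrix_adjoint, Matrix.det_conjTranspose]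
  simp

theorem continuous_basisFun_det :
    Continuous fun v : Fin n → E n => (EuclideanSpace.basisFun (Fin n) ℝ).toBasis.det v := by
  simp only [Module.Basis.det_apply]
  refine Continuous.matrix_det (continuous_matrix fun i j => ?_)
  simp only [Module.Basis.toMatrix_apply, OrthonormalBasis.coe_toBasis_repr_apply,
    EuclideanSpace.basisFun_repr]
  fun_prop

/-- A convex body with interior points contains the vertices `x₀, x₀ + B i` of a simplex such that
all points of the body have coordinates of absolute value at most `1` with respect to the frame. -/
theorem exists_maximal_simplex {K : ConvexBody (E n)} (hK : K ∈ properBodies n) :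
    ∃ x₀ ∈ K, ∃ B : Module.Basis (Fin n) ℝ (E n), (∀ i, x₀ + B i ∈ K) ∧
      ∀ x ∈ K, ∀ i, |B.repr (x - x₀) i| ≤ 1 := by
  set b := (EuclideanSpace.basisFun (Fin n) ℝ).toBasis with hb
  let f : (Fin n → E n) × E n → ℝ := fun p => |b.det fun i => p.1 i - p.2|
  have hf : Continuous f := (continuous_basisFun_det.comp
    (continuous_pi fun i => ((continuous_apply i).comp continuous_fst).sub continuous_snd)).abs
  -- A simplex of maximal volume with vertices in `K`. By Cramer's rule, replacing the vertex `v i`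
  -- by a point of `K` multiplies the determinant by the `i`-th coordinate of that point, which is
  -- therefore at most `1` in absolute value.
  obtain ⟨⟨v, x₀⟩, ⟨hv, hx₀⟩, hmax⟩ :=
    ((isCompact_univ_pi fun _ : Fin n => K.isCompact).prod K.isCompact).exists_isMaxOn
      (by
        obtain ⟨x, hx⟩ := K.nonempty
        exact ⟨(fun _ => x, x), fun _ _ => hx, hx⟩) hf.continuousOn
  have hpos : 0 < f (v, x₀) := by
    obtain ⟨e, he⟩ := hK
    obtain ⟨ρ, hρ, h⟩ := nhds_basis_closedBall.mem_iff.1 (mem_interior_iff_mem_nhds.1 he)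
    have h1 : ((fun i => e + ρ • b i : Fin n → E n), e) ∈
        (univ.pi fun _ => (K : Set (E n))) ×ˢ (K : Set (E n)) := by
      refine ⟨fun i _ => h ?_, interior_subset he⟩
      simp [hb, norm_smul, abs_of_pos hρ]
    refine lt_of_lt_of_le ?_ (hmax h1)
    have : f ((fun i => e + ρ • b i : Fin n → E n), e) = ρ ^ n := by
      simp only [f, add_sub_cancel_left]
      rw [AlternatingMap.map_smul_univ, Module.Basis.det_self]
      simp [abs_of_pos hρ]
    rw [this]
    positivity
  set w : Fin n → E n := fun i => v i - x₀
  have hdet : b.det w ≠ 0 := abs_pos.1 hpos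
  obtain ⟨hli, hsp⟩ := b.is_basis_iff_det.2 hdet.isUnit
  refine ⟨x₀, hx₀, Module.Basis.mk hli hsp.ge, fun i => ?_, fun x hx i => ?_⟩
  · simpa [w] using hv i (mem_univ i)
  · have h1 := congrArg (fun g => g (x - x₀)) (b.det_smul_mk_coord_eq_det_update hli hsp.ge i)
    simp only [LinearMap.smul_apply, smul_eq_mul, Module.Basis.coord_apply,
      MultilinearMap.toLinearMap_apply, AlternatingMap.coe_multilinearMap] at h1
    have h2 : (Function.update v i x, x₀) ∈
        (univ.pi fun _ => (K : Set (E n))) ×ˢ (K : Set (E n)) := by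
      refine ⟨fun j _ => ?_, hx₀⟩
      rcases eq_or_ne j i with rfl | hj
      · simpa using hx
      · simpa [hj] using hv j (mem_univ j)
    have h3 : f (Function.update v i x, x₀) ≤ f (v, x₀) := hmax h2
    have h4 : (fun j => Function.update v i x j - x₀) = Function.update w i (x - x₀) := by
      ext1 j
      rcases eq_or_ne j i with rfl | hj
      · simp
      · simp [hj, w]
    simp only [f, h4] at h3
    rw [← h1, abs_mul] at h3
    exact le_of_mul_le_mul_left (h3.trans_eq (mul_one _).symm) hpos

/-- Every proper convex body is pinched between two homothetic ellipsoids with common centre, the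
ratio depending only on the dimension. -/
theorem exists_ellipsoid_bounds [NeZero n] {K : ConvexBody (E n)} (hK : K ∈ properBodies n) :
    ∃ e ∈ interior (K : Set (E n)), ∃ M : E n →ₗ[ℝ] E n,
      bodyVolume K ≤ |LinearMap.det M| * ((2 * n : ℝ) ^ n * unitBallVolume n) ∧
      ∀ u : S n, 1 / ((n : ℝ) + 1) ^ 2 * ‖M u‖ ≤ supportFn K u - ⟪e, (u : E n)⟫ ∧
        supportFn K u - ⟪e, (u : E n)⟫ ≤ 2 * n * ‖M u‖ := by
  obtain ⟨x₀, hx₀, B, hB, hcoord⟩ := exists_maximal_simplex hK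
  have hn : (1 : ℝ) ≤ n := Nat.one_le_cast.2 (NeZero.one_le)
  let A : E n ≃ₗ[ℝ] E n := (WithLp.linearEquiv 2 ℝ (Fin n → ℝ)).trans B.equivFun.symm
  have hA : ∀ y : E n, A y = ∑ i, y i • B i := fun y => by simp [A, B.equivFun_symm_apply]
  set c : ℝ := 1 / ((n : ℝ) + 1)
  -- The centroid of the simplex. Shifting its coordinates `1/(n+1)` by at most `1/(n+1)^2` keeps
  -- them nonnegative with sum at most `1`. Conversely, points of `K` have coordinates at most `2`
  -- relative to `e`, hence norm at most `2√n ≤ 2n`.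
  let e : E n := x₀ + ∑ i, c • B i
  have hcoordle : ∀ (y : E n) (i : Fin n), |y i| ≤ ‖y‖ := fun y i => PiLp.norm_apply_le y i
  -- the inner ellipsoid
  have hin : ∀ y : E n, ‖y‖ ≤ 1 / ((n : ℝ) + 1) ^ 2 → e + A y ∈ K := by
    intro y hy
    have hc0 : ∀ i, 0 ≤ c + y i := fun i => by
      have h1 := (abs_le.1 ((hcoordle y i).trans hy)).1
      have h2 : 1 / ((n : ℝ) + 1) ^ 2 ≤ c := by
        apply one_div_le_one_div_of_le <;> nlinarith
      linarith
    have hsum : ∑ i, (c + y i) ≤ 1 := by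
      have h1 : ∑ i, (c + y i) ≤ ∑ _i : Fin n, (c + 1 / ((n : ℝ) + 1) ^ 2) :=
        Finset.sum_le_sum fun i _ => by
          have := (abs_le.1 ((hcoordle y i).trans hy)).2
          linarith
      refine h1.trans ?_
      simp only [Finset.sum_const, Finset.card_univ, Fintype.card_fin, nsmul_eq_mul, c]
      rw [div_add_div _ _ (by positivity) (by positivity), mul_div_assoc', div_le_one (by positivity)]
      nlinarith
    have h1 := K.convex.sum_mem (t := Finset.univ)
      (w := fun o : Option (Fin n) => o.elim (1 - ∑ i, (c + y i)) fun i => c + y i)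
      (z := fun o : Option (Fin n) => o.elim x₀ fun i => x₀ + B i)
      (by rintro (_ | i) -
          · simpa using hsum
          · exact hc0 i)
      (by simp [Fintype.sum_option])
      (by rintro (_ | i) -
          · exact hx₀
          · exact hB i)
    simp only [Fintype.sum_option, Option.elim, SetLike.mem_coe] at h1
    convert h1 using 1
    simp only [e, hA, smul_add, add_smul, Finset.sum_add_distrib, sub_smul, one_smul,
      Finset.sum_smul]
    abel
  have hout : ∀ x ∈ K, ∃ y : E n, ‖y‖ ≤ 2 * n ∧ x = e + A y := by
    intro x hx
    refine ⟨A.symm (x - e), ?_, by simp⟩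
    have h1 : ∀ i, A.symm (x - e) i = B.repr (x - x₀) i - c := by
      intro i
      have h2 : A.symm (x - e) = WithLp.toLp 2 (B.equivFun (x - e)) := rfl
      have h3 : x - e = (x - x₀) - ∑ i, c • B i := by simp only [e]; abel
      have h4 : B.equivFun (∑ i, c • B i) i = c := by
        have := congrFun (B.equivFun.apply_symm_apply (fun _ => c)) i
        rwa [B.equivFun_symm_apply] at this
      rw [h2, h3, map_sub]
      simp only [Pi.sub_apply] at h4 ⊢
      rw [h4, B.equivFun_apply]
    have hc1 : 0 ≤ c ∧ c ≤ 1 := ⟨by positivity, by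
      simp only [c]; rw [div_le_one (by positivity)]; linarith⟩
    have h2 : ∀ i, ‖A.symm (x - e) i‖ ≤ 2 := fun i => by
      rw [h1, Real.norm_eq_abs]
      have := abs_le.1 (hcoord x hx i)
      rw [abs_le]; constructor <;> linarith
    rw [EuclideanSpace.norm_eq]
    apply Real.sqrt_le_iff.2 ⟨by positivity, ?_⟩
    calc ∑ i, ‖A.symm (x - e) i‖ ^ 2 ≤ ∑ _i : Fin n, (2 : ℝ) ^ 2 := by gcongr; exact h2 _
      _ = n * 4 := by simp; norm_num
      _ ≤ (2 * n) ^ 2 := by nlinarith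
  -- The adjoint appears because the support function of the image of the unit ball under `A` is
  -- `‖A* u‖`.
  refine ⟨e, ?_, LinearMap.adjoint (A : E n →ₗ[ℝ] E n), ?_, fun u => ⟨?_, ?_⟩⟩
  · have hopen : IsOpen ((fun y => e + A y) '' ball 0 (1 / ((n : ℝ) + 1) ^ 2)) :=
      (((A.toContinuousLinearEquiv).toHomeomorph.trans (Homeomorph.addLeft e)).isOpenMap) _
        isOpen_ball
    refine interior_maximal ?_ hopen ⟨0, mem_ball_self (by positivity), by simp⟩
    rintro _ ⟨y, hy, rfl⟩
    exact hin y (by simpa using (mem_ball_zero_iff.1 hy).le)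
  · rw [abs_det_adjoint]
    have h1 : (K : Set (E n)) ⊆ (fun x => e + x) '' (A '' closedBall 0 (2 * n)) := by
      intro x hx
      obtain ⟨y, hy, rfl⟩ := hout x hx
      exact ⟨_, ⟨y, by simpa using hy, rfl⟩, rfl⟩
    have hfin : volume (A '' closedBall (0 : E n) (2 * n)) ≠ ⊤ :=
      ((isCompact_closedBall _ _).image A.toContinuousLinearEquiv.continuous).measure_lt_top.ne
    have h2 : volume (K : Set (E n)) ≤ volume (A '' closedBall (0 : E n) (2 * n)) := by
      refine (measure_mono h1).trans_eq ?_
      rw [image_add_left, measure_preimage_add]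
    have h3 := ENNReal.toReal_mono hfin h2
    have h4 : volume (A '' closedBall (0 : E n) (2 * n)) =
      ENNReal.ofReal |LinearMap.det (A : E n →ₗ[ℝ] E n)| * volume (closedBall (0 : E n) (2 * n)) :=
      Measure.addHaar_image_linearMap volume (A : E n →ₗ[ℝ] E n) _
    rw [h4, Measure.addHaar_closedBall' _ _ (by positivity), ENNReal.toReal_mul,
      ENNReal.toReal_mul, ENNReal.toReal_ofReal (by positivity),
      ENNReal.toReal_ofReal (by positivity), finrank_euclideanSpace_fin] at h3
    exact h3
  · set z := LinearMap.adjoint (A : E n →ₗ[ℝ] E n) u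
    rcases eq_or_ne z 0 with hz | hz
    · rw [hz, norm_zero, mul_zero, sub_nonneg]
      have := hin 0 (by simp; positivity)
      exact inner_le_supportFn K u (by simpa using this)
    · have hz' : ‖z‖ ≠ 0 := norm_ne_zero_iff.2 hz
      have h1 := inner_le_supportFn K u (hin ((1 / ((n : ℝ) + 1) ^ 2) • ‖z‖⁻¹ • z) (by
        rw [norm_smul, norm_smul, norm_inv, norm_norm, inv_mul_cancel₀ hz', mul_one,
          Real.norm_of_nonneg (by positivity)]))
      have h2 : ⟪A ((1 / ((n : ℝ) + 1) ^ 2) • ‖z‖⁻¹ • z), (u : E n)⟫ =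
          1 / ((n : ℝ) + 1) ^ 2 * ‖z‖ := by
        rw [← LinearEquiv.coe_coe, ← LinearMap.adjoint_inner_right, real_inner_smul_left,
          real_inner_smul_left, real_inner_self_eq_norm_sq]
        field_simp
      rw [inner_add_left, h2] at h1
      linarith
  · rw [sub_le_iff_le_add]
    refine supportFn_le K u fun x hx => ?_
    obtain ⟨y, hy, rfl⟩ := hout x hx
    rw [inner_add_left, ← LinearEquiv.coe_coe, ← LinearMap.adjoint_inner_right]
    have := real_inner_le_norm y (LinearMap.adjoint (A : E n →ₗ[ℝ] E n) u)
    have := mul_le_mul_of_nonneg_right hy (norm_nonneg (LinearMap.adjoint (A : E n →ₗ[ℝ] E n) u))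
    linarith

end MaximalSimplex

/-! ### Upper bounds for the support function, and the inball -/

section UpperBound
variable {n : ℕ}

theorem exists_one_div_bounds [NeZero n] {φ : S n → ℝ} (hφ : Continuous φ) (hφ0 : ∀ u, 0 < φ u) :
    ∃ m > 0, ∃ C > 0, ∀ u, m ≤ 1 / φ u ∧ 1 / φ u ≤ C := by
  have hc : Continuous fun u => 1 / φ u := continuous_const.div hφ fun u => (hφ0 u).ne'
  obtain ⟨u, -, hu⟩ := isCompact_univ.exists_isMinOn univ_nonempty hc.continuousOn
  obtain ⟨v, -, hv⟩ := isCompact_univ.exists_isMaxOn univ_nonempty hc.continuousOn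
  exact ⟨_, one_div_pos.2 (hφ0 u), _, one_div_pos.2 (hφ0 v), fun x =>
    ⟨hu (mem_univ x), hv (mem_univ x)⟩⟩

theorem half_le_inner_of_dist_lt_one {u w : S n} (h : dist u w < 1) :
    1 / 2 ≤ ⟪(w : E n), (u : E n)⟫ := by
  rw [Subtype.dist_eq, dist_eq_norm] at h
  have h1 := norm_sub_sq_real (u : E n) w
  rw [norm_sphere_coe, norm_sphere_coe] at h1
  rw [real_inner_comm]
  nlinarith [norm_nonneg ((u : E n) - w)]

theorem Continuous.div_weight {f φ : S n → ℝ} (hf : Continuous f) (hφ : Continuous φ)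
    (hφ0 : ∀ u, 0 < φ u) : Integrable (fun u => f u / φ u) (sphereMeasure n) :=
  (hf.div hφ fun u => (hφ0 u).ne').integrable_sphereMeasure

/-- A point `x` of `K` attaining `H = h_K(v)` has norm at least `H`, so `h_K ≥ H / 2` on the cap of
radius `1` around the direction of `x`. -/
theorem exists_supportFn_le_of_integral_rpow_le [NeZero n] {φ : S n → ℝ} (hφ : Continuous φ)
    (hφ0 : ∀ u, 0 < φ u) {p a : ℝ} (hp : 0 < p) (ha : 0 < a) :
    ∃ R > 0, ∀ K : ConvexBody (E n), (0 : E n) ∈ interior (K : Set (E n)) →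
      ∫ u, supportFn K u ^ p / φ u ∂(sphereMeasure n) ≤ a → ∀ u, supportFn K u ≤ R := by
  obtain ⟨m, hm, _, _, hmφ⟩ := exists_one_div_bounds hφ hφ0
  obtain ⟨κ, hκ, hball⟩ := exists_le_sphereMeasure_ball (n := n) one_pos
  refine ⟨2 * (a / (κ * m)) ^ p⁻¹, by positivity, fun K hK hle v => ?_⟩
  have hH := supportFn_pos hK v
  obtain ⟨x, hx, hxv⟩ := exists_inner_eq_supportFn K v
  set H := supportFn K v
  have hHx : H ≤ ‖x‖ := by
    have := real_inner_le_norm x (v : E n)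
    rwa [norm_sphere_coe, mul_one, hxv] at this
  have hx0 : x ≠ 0 := norm_pos_iff.1 (hH.trans_le hHx)
  have hcap : ∀ u ∈ ball (direction x hx0) 1, H / 2 ≤ supportFn K u := by
    intro u hu
    refine le_trans ?_ (inner_le_supportFn K u hx)
    have h1 := half_le_inner_of_dist_lt_one hu
    simp only [direction, real_inner_smul_left] at h1
    rw [le_inv_mul_iff₀ (norm_pos_iff.2 hx0)] at h1
    linarith
  have hpt : ∀ u, (ball (direction x hx0) 1).indicator (fun _ => (H / 2) ^ p * m) u ≤
      supportFn K u ^ p / φ u := by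
    intro u
    by_cases hu : u ∈ ball (direction x hx0) 1
    · rw [indicator_of_mem hu, div_eq_mul_one_div (supportFn K u ^ p)]
      exact mul_le_mul (Real.rpow_le_rpow (by positivity) (hcap u hu) hp.le) (hmφ u).1 hm.le
        (Real.rpow_nonneg (supportFn_pos hK u).le _)
    · rw [indicator_of_notMem hu]
      exact div_nonneg (Real.rpow_nonneg (supportFn_pos hK u).le _) (hφ0 u).le
  have h2 := integral_mono ((integrable_const _).indicator measurableSet_ball)
    (((continuous_supportFn K).rpow_const
      fun u => Or.inl (supportFn_pos hK u).ne').div_weight hφ hφ0) hpt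
  rw [integral_indicator_const _ measurableSet_ball, smul_eq_mul] at h2
  have h3 : κ * ((H / 2) ^ p * m) ≤ a :=
    (mul_le_mul_of_nonneg_right (hball _) (by positivity)).trans (h2.trans hle)
  have h4 : (H / 2) ^ p ≤ a / (κ * m) := by
    rw [le_div_iff₀ (by positivity)]
    linarith
  have h5 := Real.rpow_le_rpow (by positivity) h4 (inv_nonneg.2 hp.le)
  rw [← Real.rpow_mul (by positivity), mul_inv_cancel₀ hp.ne', Real.rpow_one] at h5
  linarith

/-- This is `log y ≤ y - 1` at `y = (l / t) ^ (1/2)`; it reduces the logarithmic case to a negative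
power. -/
theorem log_ge_of_pos {t l : ℝ} (ht : 0 < t) (hl : 0 < l) :
    Real.log l + 2 - 2 * l ^ (1 / 2 : ℝ) * t ^ (-(1 / 2) : ℝ) ≤ Real.log t := by
  have h := Real.log_le_sub_one_of_pos (x := l ^ (1 / 2 : ℝ) * t ^ (-(1 / 2) : ℝ)) (by positivity)
  rw [Real.log_mul (by positivity) (by positivity), Real.log_rpow hl, Real.log_rpow ht] at h
  linarith

/-- The function `g` is left general because it is `h_K(u) - e · u` for bodies with an entropy point
and `h_K` itself for symmetric ones. -/
theorem exists_norm_map_lt [NeZero n] {φ : S n → ℝ} (hφ : Continuous φ) (hφ0 : ∀ u, 0 < φ u)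
    {p a c r : ℝ} (C : ℝ) (hpn : -(n : ℝ) < p) (hp : p ≤ 0) (ha : 0 < a) (hc : 0 < c)
    (hr : 0 < r) :
    ∃ B > 0, ∀ M : E n →ₗ[ℝ] E n, c ≤ |LinearMap.det M| → ∀ g : S n → ℝ, Continuous g →
      (∀ u : S n, r * ‖M u‖ ≤ g u) →
      (p = 0 → ∫ u, Real.log (g u) / φ u ∂(sphereMeasure n) ≤ C) →
      (p < 0 → a ≤ ∫ u, g u ^ p / φ u ∂(sphereMeasure n)) → ∀ u : S n, ‖M u‖ < B := by
  obtain ⟨m, hm, D, hD, hmφ⟩ := exists_one_div_bounds hφ hφ0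
  have hpos : ∀ M : E n →ₗ[ℝ] E n, c ≤ |LinearMap.det M| → ∀ g : S n → ℝ,
      (∀ u : S n, r * ‖M u‖ ≤ g u) → ∀ u, 0 < g u := fun M hM g hg u =>
    lt_of_lt_of_le (mul_pos hr (norm_pos_iff.2
      (map_sphere_ne_zero (abs_pos.1 (hc.trans_le hM)) u))) (hg u)
  -- the common estimate for negative exponents
  have key : ∀ q : ℝ, -(n : ℝ) < q → q < 0 → ∀ δ > 0, ∃ B > 0, ∀ M : E n →ₗ[ℝ] E n,
      c ≤ |LinearMap.det M| → ∀ g : S n → ℝ, Continuous g → (∀ u : S n, r * ‖M u‖ ≤ g u) →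
      δ ≤ ∫ u, g u ^ q / φ u ∂(sphereMeasure n) → ∀ u : S n, ‖M u‖ < B := by
    intro q hqn hq δ hδ
    obtain ⟨B, hB, h⟩ := exists_integral_norm_map_rpow_le (n := n) hqn hq hc
      (δ := δ / (2 * (r ^ q * D))) (by positivity)
    refine ⟨B, hB, fun M hM g hgc hg hle u => ?_⟩
    by_contra! hu
    have hdet := abs_pos.1 (hc.trans_le hM)
    have h1 := h M hM u hu
    have h2 : ∫ u, g u ^ q / φ u ∂(sphereMeasure n) ≤
        ∫ u : S n, r ^ q * D * ‖M u‖ ^ q ∂(sphereMeasure n) := by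
      refine integral_mono ((hgc.rpow_const fun u => Or.inl (hpos M hM g hg u).ne').div_weight
        hφ hφ0) ((continuous_norm_map_rpow hdet q).const_mul _).integrable_sphereMeasure
        fun v => ?_
      have hv := norm_pos_iff.2 (map_sphere_ne_zero hdet v)
      have h3 := Real.rpow_le_rpow_of_nonpos (by positivity) (hg v) hq.le
      rw [Real.mul_rpow hr.le hv.le] at h3
      calc g v ^ q / φ v = g v ^ q * (1 / φ v) := div_eq_mul_one_div _ _
        _ ≤ (r ^ q * ‖M v‖ ^ q) * D := by
          gcongr
          · exact (one_div_pos.2 (hφ0 v)).le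
          · exact (hmφ v).2
        _ = _ := by ring
    rw [integral_const_mul] at h2
    have h4 := hle.trans (h2.trans (mul_le_mul_of_nonneg_left h1 (by positivity)))
    have h5 : r ^ q * D * (δ / (2 * (r ^ q * D))) = δ / 2 := by field_simp
    linarith
  rcases hp.lt_or_eq with hp | rfl
  · obtain ⟨B, hB, h⟩ := key p hpn hp a ha
    exact ⟨B, hB, fun M hM g hgc hg _ hle => h M hM g hgc hg (hle hp)⟩
  set Φ := ∫ u, 1 / φ u ∂(sphereMeasure n) with hΦdef
  have hΦ : 0 < Φ := by
    have h1 := integral_mono (integrable_const m) (continuous_const.div_weight hφ hφ0)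
      (fun u => (hmφ u).1)
    rw [integral_const, smul_eq_mul] at h1
    refine lt_of_lt_of_le (mul_pos ?_ hm) h1
    exact ENNReal.toReal_pos (isOpen_univ.measure_ne_zero _ univ_nonempty)
      (measure_ne_top _ _)
  -- Chosen so that `Φ log l = C`: the terms in `C` then cancel and a lower bound on the integral of
  -- `g ^ (-1/2) / φ` remains. The exponent `-1/2` exceeds `-n` in every dimension.
  set l := Real.exp (C / Φ) with hl
  have hl0 : 0 < l := Real.exp_pos _
  have h1n : (1 : ℝ) ≤ n := Nat.one_le_cast.2 (NeZero.one_le)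
  obtain ⟨B, hB, h⟩ := key (-(1 / 2)) (by linarith) (by norm_num) (Φ / l ^ (1 / 2 : ℝ))
    (by positivity)
  refine ⟨B, hB, fun M hM g hgc hg hle _ => h M hM g hgc hg ?_⟩
  have hg0 := hpos M hM g hg
  have hi1 : Integrable (fun u => (Real.log l + 2) * (1 / φ u)) (sphereMeasure n) :=
    (continuous_const.div_weight hφ hφ0).const_mul _
  have hi2 : Integrable (fun u => 2 * l ^ (1 / 2 : ℝ) * (g u ^ (-(1 / 2) : ℝ) / φ u))
      (sphereMeasure n) :=
    ((hgc.rpow_const fun u => Or.inl (hg0 u).ne').div_weight hφ hφ0).const_mul _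
  have h2 := integral_mono (hi1.sub hi2)
    ((hgc.log fun u => (hg0 u).ne').div_weight hφ hφ0) (fun u => by
      have := mul_le_mul_of_nonneg_right (log_ge_of_pos (hg0 u) hl0)
        (one_div_pos.2 (hφ0 u)).le
      calc _ = _ := ?_
        _ ≤ _ := this
        _ = _ := by ring
      simp only [Pi.sub_apply]
      ring)
  rw [integral_sub' hi1 hi2, integral_const_mul, integral_const_mul, ← hΦdef, hl, Real.log_exp,
    ← hl] at h2
  have h3 := h2.trans (hle rfl)
  have h4 : (C / Φ + 2) * Φ = C + 2 * Φ := by field_simp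
  rw [h4] at h3
  rw [div_le_iff₀ (by positivity)]
  nlinarith

theorem IsEntropyPoint.integral_inner_mul {φ : S n → ℝ} (hφ : Continuous φ) (hφ0 : ∀ u, 0 < φ u)
    {p : ℝ} {K : ConvexBody (E n)} (h : IsEntropyPoint φ p K 0) (x : E n) :
    ∫ u : S n, ⟪x, (u : E n)⟫ * (supportFn K u ^ (p - 1) / φ u) ∂(sphereMeasure n) = 0 := by
  obtain ⟨h0, h1⟩ := h
  have hpos := supportFn_pos h0
  have heq : ∀ u : S n, 1 / (φ u * (supportFn K u - ⟪(0 : E n), (u : E n)⟫) ^ (1 - p)) =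
      supportFn K u ^ (p - 1) / φ u := fun u => by
    rw [inner_zero_left, sub_zero, show p - 1 = -(1 - p) by ring, Real.rpow_neg (hpos u).le]
    field_simp
  simp only [heq] at h1
  have hc : Continuous fun u : S n => (supportFn K u ^ (p - 1) / φ u) • (u : E n) :=
    (((continuous_supportFn K).rpow_const fun u => Or.inl (hpos u).ne').div hφ
      fun u => (hφ0 u).ne').smul continuous_subtype_val
  have hi : Integrable (fun u : S n => (supportFn K u ^ (p - 1) / φ u) • (u : E n))
      (sphereMeasure n) :=
    integrableOn_univ.1 (hc.continuousOn.integrableOn_compact isCompact_univ)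
  have h2 := integral_inner (𝕜 := ℝ) hi x
  rw [h1, inner_zero_right] at h2
  rw [← h2]
  congr 1
  ext u
  rw [real_inner_smul_right, mul_comm]

/-- Convexity of the power, written as a tangent line so that its linear term can be integrated
against the entropy condition. -/
theorem rpow_tangent_le {p s t : ℝ} (hp : p ≤ 0) (hs : 0 < s) (ht : 0 < t) :
    s ^ p + p * s ^ (p - 1) * (t - s) ≤ t ^ p := by
  have h1 : 1 + p * (t / s - 1) ≤ (t / s) ^ p := by
    have hx : 0 < t / s := by positivity
    have h2 := Real.add_one_le_exp (Real.log (t / s) * p)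
    have h3 := mul_le_mul_of_nonpos_right (Real.log_le_sub_one_of_pos hx) hp
    rw [Real.rpow_def_of_pos hx]
    linarith
  rw [Real.div_rpow ht.le hs.le, le_div_iff₀ (by positivity)] at h1
  rw [Real.rpow_sub_one hs.ne']
  refine le_trans (le_of_eq ?_) h1
  field_simp

/-- The origin minimizes the integral over all centres `e`: in the tangent inequality at `h_K(u)`
the term linear in `e` integrates to zero. -/
theorem IsEntropyPoint.integral_rpow_le {φ : S n → ℝ} (hφ : Continuous φ) (hφ0 : ∀ u, 0 < φ u)
    {p : ℝ} (hp : p ≤ 0) {K : ConvexBody (E n)} (h : IsEntropyPoint φ p K 0) {e : E n}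
    (he : e ∈ interior (K : Set (E n))) :
    ∫ u, supportFn K u ^ p / φ u ∂(sphereMeasure n) ≤
      ∫ u : S n, (supportFn K u - ⟪e, (u : E n)⟫) ^ p / φ u ∂(sphereMeasure n) := by
  have hpos := supportFn_pos h.1
  have hpos' : ∀ u : S n, 0 < supportFn K u - ⟪e, (u : E n)⟫ := fun u => by
    obtain ⟨ρ, hρ, h⟩ := exists_add_le_supportFn he
    linarith [h u]
  have hc := continuous_supportFn K
  have hi : Continuous fun u : S n => ⟪e, (u : E n)⟫ := by fun_prop
  have hi1 := (hc.rpow_const (p := p) fun u => Or.inl (hpos u).ne').div_weight hφ hφ0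
  have hi2 : Integrable (fun u : S n => ⟪e, (u : E n)⟫ * (supportFn K u ^ (p - 1) / φ u))
      (sphereMeasure n) := (hi.mul ((hc.rpow_const (p := p - 1)
        fun u => Or.inl (hpos u).ne').div hφ fun u => (hφ0 u).ne')).integrable_sphereMeasure
  have hi3 := ((hc.sub hi).rpow_const (p := p) fun u => Or.inl (hpos' u).ne').div_weight hφ hφ0
  have h1 := integral_mono (hi1.sub (hi2.const_mul p)) hi3 (fun u => by
    have h2 := div_le_div_of_nonneg_right (rpow_tangent_le hp (hpos u) (hpos' u)) (hφ0 u).le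
    refine le_trans (le_of_eq ?_) h2
    simp only [Pi.sub_apply]
    ring)
  rwa [integral_sub' hi1 (hi2.const_mul p), integral_const_mul,
    h.integral_inner_mul hφ hφ0 e, mul_zero, sub_zero] at h1

/-- The logarithmic counterpart: by concavity the origin maximizes the integral over all centres. -/
theorem IsEntropyPoint.integral_log_le {φ : S n → ℝ} (hφ : Continuous φ) (hφ0 : ∀ u, 0 < φ u)
    {K : ConvexBody (E n)} (h : IsEntropyPoint φ 0 K 0) {e : E n}
    (he : e ∈ interior (K : Set (E n))) :
    ∫ u : S n, Real.log (supportFn K u - ⟪e, (u : E n)⟫) / φ u ∂(sphereMeasure n) ≤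
      ∫ u, Real.log (supportFn K u) / φ u ∂(sphereMeasure n) := by
  have hpos := supportFn_pos h.1
  have hpos' : ∀ u : S n, 0 < supportFn K u - ⟪e, (u : E n)⟫ := fun u => by
    obtain ⟨ρ, hρ, h⟩ := exists_add_le_supportFn he
    linarith [h u]
  have hc := continuous_supportFn K
  have hi : Continuous fun u : S n => ⟪e, (u : E n)⟫ := by fun_prop
  have hi1 := (hc.log fun u => (hpos u).ne').div_weight hφ hφ0
  have hi2 : Integrable (fun u : S n => ⟪e, (u : E n)⟫ * (supportFn K u ^ ((0 : ℝ) - 1) / φ u))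
      (sphereMeasure n) := (hi.mul ((hc.rpow_const (p := 0 - 1)
        fun u => Or.inl (hpos u).ne').div hφ fun u => (hφ0 u).ne')).integrable_sphereMeasure
  have hi3 := ((hc.sub hi).log fun u => (hpos' u).ne').div_weight hφ hφ0
  have h1 := integral_mono hi3 (hi1.sub hi2) (fun u => by
    have h2 := Real.log_le_sub_one_of_pos (div_pos (hpos' u) (hpos u))
    rw [Real.log_div (hpos' u).ne' (hpos u).ne', sub_le_iff_le_add] at h2
    refine (div_le_div_of_nonneg_right h2 (hφ0 u).le).trans (le_of_eq ?_)
    simp only [Pi.sub_apply]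
    rw [zero_sub, Real.rpow_neg_one]
    have := (hpos u).ne'
    have := (hφ0 u).ne'
    field_simp
    ring)
  rwa [integral_sub' hi1 hi2, h.integral_inner_mul hφ hφ0 e, sub_zero] at h1

/-- The width `h_K(u) + h_K(-u)` does not depend on the centre, and `h_K(-u) ≥ 0`; so no control on
`e` is needed. -/
theorem supportFn_le_two_mul {K : ConvexBody (E n)} (h0 : (0 : E n) ∈ K) {e : E n} {D : ℝ}
    (h : ∀ u : S n, supportFn K u - ⟪e, (u : E n)⟫ ≤ D) (u : S n) : supportFn K u ≤ 2 * D := by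
  have h1 := inner_le_supportFn K (-u) h0
  have h2 := h (-u)
  have h3 := h u
  have h4 : ⟪e, ((-u : S n) : E n)⟫ = -⟪e, (u : E n)⟫ := by simp
  rw [inner_zero_left] at h1
  linarith

theorem exists_pos_le_abs_det [NeZero n] : ∃ c > 0, ∀ K : ConvexBody (E n), ∀ M : E n →ₗ[ℝ] E n,
    bodyVolume K = unitBallVolume n →
    bodyVolume K ≤ |LinearMap.det M| * ((2 * n : ℝ) ^ n * unitBallVolume n) →
    c ≤ |LinearMap.det M| := by
  have hω := unitBallVolume_pos (n := n)
  have hn : (0 : ℝ) < n := Nat.cast_pos.2 (NeZero.pos n)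
  refine ⟨1 / (2 * n : ℝ) ^ n, by positivity, fun K M hV h => ?_⟩
  rw [hV, ← mul_assoc] at h
  rw [div_le_iff₀ (by positivity)]
  exact le_of_mul_le_mul_right (by rwa [one_mul]) hω

theorem EntropyBound.integral_log_le {φ : S n → ℝ} {a : ℝ} (ha : 0 < a) {K : ConvexBody (E n)}
    (h : EntropyBound φ 0 a K) : ∫ u, Real.log (supportFn K u) / φ u ∂(sphereMeasure n) ≤
      -(unitBallVolume n * Real.log a) := by
  have h1 := h.2.1 rfl
  rw [← Real.log_le_iff_le_exp ha, integral_neg, one_div, inv_mul_eq_div,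
    le_div_iff₀ unitBallVolume_pos] at h1
  linarith

theorem exists_supportFn_le_of_entropyPoint [NeZero n] {φ : S n → ℝ} (hφ : Continuous φ)
    (hφ0 : ∀ u, 0 < φ u) {p a : ℝ} (hpn : -(n : ℝ) < p) (hp : p ≤ 0) (ha : 0 < a) :
    ∃ R > 0, ∀ K ∈ properBodies n, bodyVolume K = unitBallVolume n → IsEntropyPoint φ p K 0 →
      (p = 0 → EntropyBound φ p a K) →
      (p < 0 → a ≤ ∫ u, supportFn K u ^ p / φ u ∂(sphereMeasure n)) →
      ∀ u, supportFn K u ≤ R := by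
  have hn : (0 : ℝ) < n := Nat.cast_pos.2 (NeZero.pos n)
  obtain ⟨c, hc, hdet⟩ := exists_pos_le_abs_det (n := n)
  obtain ⟨B, hB, h⟩ := exists_norm_map_lt hφ hφ0 (-(unitBallVolume n * Real.log a)) hpn hp ha hc
    (r := 1 / ((n : ℝ) + 1) ^ 2) (by positivity)
  refine ⟨2 * (2 * n * B), by positivity, fun K hK hV hE hb0 hbneg => ?_⟩
  obtain ⟨e, he, M, hvol, hM⟩ := exists_ellipsoid_bounds hK
  refine supportFn_le_two_mul (interior_subset hE.1) (e := e) fun u => (hM u).2.trans ?_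
  have := h M (hdet K M hV hvol) (fun u => supportFn K u - ⟪e, (u : E n)⟫)
    ((continuous_supportFn K).sub (by fun_prop)) (fun u => (hM u).1)
    (by rintro rfl; exact (hE.integral_log_le hφ hφ0 he).trans ((hb0 rfl).integral_log_le ha))
    (fun hp' => (hbneg hp').trans (hE.integral_rpow_le hφ hφ0 hp he)) u
  gcongr

theorem exists_supportFn_le_of_symmetric [NeZero n] {φ : S n → ℝ} (hφ : Continuous φ)
    (hφ0 : ∀ u, 0 < φ u) {p a : ℝ} (hpn : -(n : ℝ) < p) (hp : p ≤ 0) (ha : 0 < a) :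
    ∃ R > 0, ∀ K ∈ symmetricBodies n, bodyVolume K = unitBallVolume n → EntropyBound φ p a K →
      ∀ u, supportFn K u ≤ R := by
  have hn : (0 : ℝ) < n := Nat.cast_pos.2 (NeZero.pos n)
  obtain ⟨c, hc, hdet⟩ := exists_pos_le_abs_det (n := n)
  obtain ⟨B, hB, h⟩ := exists_norm_map_lt hφ hφ0 (-(unitBallVolume n * Real.log a)) hpn hp ha hc
    (r := 1 / ((n : ℝ) + 1) ^ 2) (by positivity)
  refine ⟨2 * (2 * n * B), by positivity, fun K hK hV hb => ?_⟩
  have h0 := zero_mem_interior_of_symmetric hK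
  obtain ⟨e, he, M, hvol, hM⟩ := exists_ellipsoid_bounds hK.1
  refine supportFn_le_two_mul (interior_subset h0) (e := e) fun u => (hM u).2.trans ?_
  have := h M (hdet K M hV hvol) (supportFn K) (continuous_supportFn K)
    -- Averaging the lower bounds at `u` and `-u` cancels the unknown centre `e`.
    (fun u => by
      have h1 := (hM u).1
      have h2 := (hM (-u)).1
      have h3 : ⟪e, ((-u : S n) : E n)⟫ = -⟪e, (u : E n)⟫ := by simp
      have h4 : ‖M ((-u : S n) : E n)‖ = ‖M u‖ := by simp
      rw [supportFn_neg_of_symmetric hK.2, h3, h4] at h2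
      linarith)
    (by rintro rfl; exact hb.integral_log_le ha) hb.2.2 u
  gcongr

/-- Needed for the weighted class with `n = 1`, `p = 0`, where the bound on the integral reads `a ≤
∫ 1 / φ` and does not involve `K`. -/
theorem supportFn_le_two_of_dim_one {K : ConvexBody (E 1)} (h0 : (0 : E 1) ∈ K)
    (hV : bodyVolume K = unitBallVolume 1) (u : S 1) : supportFn K u ≤ 2 := by
  obtain ⟨x, hx, hxu⟩ := exists_inner_eq_supportFn K u
  have h1 := real_inner_le_norm x (u : E 1)
  rw [norm_sphere_coe, mul_one, hxu] at h1
  refine h1.trans ?_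
  have hnorm : ∀ y : E 1, ‖y‖ = |y 0| := fun y => by
    simp [EuclideanSpace.norm_eq, Real.sqrt_sq_eq_abs]
  by_cases hx0 : x = 0
  · simp [hx0]
  have hx0' : x 0 ≠ 0 := by
    rw [← abs_pos, ← hnorm]
    exact norm_pos_iff.2 hx0
  -- In dimension one this ball is the segment from the origin to `x`.
  have hsub : closedBall ((1 / 2 : ℝ) • x) (‖x‖ / 2) ⊆ (K : Set (E 1)) := by
    intro y hy
    rw [mem_closedBall, dist_eq_norm, hnorm, hnorm] at hy
    have hy1 : y = (y 0 / x 0) • x := by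
      ext i
      fin_cases i
      simp [hx0']
    have h2 : |y 0 / x 0 - 1 / 2| ≤ 1 / 2 := by
      have : y 0 / x 0 - 1 / 2 = (y 0 - 1 / 2 * x 0) / x 0 := by field_simp
      rw [this, abs_div, div_le_iff₀ (abs_pos.2 hx0')]
      simp only [PiLp.sub_apply, PiLp.smul_apply, smul_eq_mul] at hy
      linarith
    rw [hy1]
    have h3 := abs_le.1 h2
    exact K.convex.smul_mem_of_zero_mem h0 hx ⟨by linarith, by linarith⟩
  have h2 := measureReal_mono (μ := volume) hsub K.isCompact.measure_lt_top.ne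
  have h3 : volume.real (closedBall ((1 / 2 : ℝ) • x) (‖x‖ / 2)) =
      ‖x‖ / 2 * unitBallVolume 1 := by
    rw [measureReal_def, Measure.addHaar_closedBall' _ _ (by positivity), ENNReal.toReal_mul,
      finrank_euclideanSpace_fin, ENNReal.toReal_ofReal (by positivity), pow_one]
    rfl
  rw [h3] at h2
  change _ ≤ bodyVolume K at h2
  rw [hV] at h2
  have := unitBallVolume_pos (n := 1)
  have h4 : ‖x‖ / 2 ≤ 1 := le_of_mul_le_mul_right (by rwa [one_mul]) this
  linarith

/-- If `‖M u‖` were small, `K - e` would lie in a slab too thin for its volume; hence the inner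
ellipsoid contains a ball of fixed radius. -/
theorem exists_inball [NeZero n] {R : ℝ} (hR0 : 0 < R) :
    ∃ ρ > 0, ∀ K ∈ properBodies n, bodyVolume K = unitBallVolume n →
      (∀ u, supportFn K u ≤ R) → ∃ c ∈ K, ∀ u : S n, ⟪c, (u : E n)⟫ + ρ ≤ supportFn K u := by
  have hn : (0 : ℝ) < n := Nat.cast_pos.2 (NeZero.pos n)
  obtain ⟨t, ht, hslab⟩ := exists_slab_volume_lt (n := n) (2 * R)
    (η := ENNReal.ofReal (unitBallVolume n)) (by simpa using unitBallVolume_pos)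
  refine ⟨1 / ((n : ℝ) + 1) ^ 2 * (t / (2 * n)), by positivity, fun K hK hV hR => ?_⟩
  obtain ⟨e, he, M, -, hM⟩ := exists_ellipsoid_bounds hK
  refine ⟨e, interior_subset he, fun u => ?_⟩
  suffices t / (2 * n) ≤ ‖M u‖ by
    have h1 := (hM u).1
    have : 1 / ((n : ℝ) + 1) ^ 2 * (t / (2 * n)) ≤ 1 / ((n : ℝ) + 1) ^ 2 * ‖M u‖ := by gcongr
    linarith
  by_contra! hlt
  rw [lt_div_iff₀ (by positivity)] at hlt
  have hsub : (fun x => -e + x) '' (K : Set (E n)) ⊆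
      {x : E n | ‖x‖ ≤ 2 * R ∧ |⟪x, (u : E n)⟫| ≤ t} := by
    rintro _ ⟨x, hx, rfl⟩
    refine ⟨?_, ?_⟩
    · have h1 := norm_le_of_supportFn_le hR0.le hR hx
      have h2 := norm_le_of_supportFn_le hR0.le hR (interior_subset he)
      have h3 := norm_add_le (-e) x
      rw [norm_neg] at h3
      linarith
    · have h1 := (hM u).2
      have h2 := (hM (-u)).2
      have h3 := inner_le_supportFn K u hx
      have h4 := inner_le_supportFn K (-u) hx
      have h5 : ∀ y : E n, ⟪y, ((-u : S n) : E n)⟫ = -⟪y, (u : E n)⟫ := fun y => by simp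
      have h6 : ‖M ((-u : S n) : E n)‖ = ‖M u‖ := by simp
      rw [h5, h6] at h2
      rw [h5] at h4
      simp only [inner_add_left, inner_neg_left]
      rw [abs_le]
      constructor <;> linarith
  have h1 := (measure_mono hsub).trans_lt (hslab u)
  rw [image_add_left, measure_preimage_add, ← hV, bodyVolume,
    ofReal_measureReal K.isCompact.measure_lt_top.ne] at h1
  exact lt_irrefl _ h1

end UpperBound

/-! ### Lower bounds for the support function -/

section LowerBound
variable {n : ℕ}

theorem exists_le_supportFn_of_symmetric [NeZero n] {R : ℝ} (hR0 : 0 < R) :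
    ∃ r > 0, ∀ K ∈ symmetricBodies n, bodyVolume K = unitBallVolume n →
      (∀ u, supportFn K u ≤ R) → ∀ u, r ≤ supportFn K u := by
  obtain ⟨t, ht, hslab⟩ := exists_slab_volume_lt (n := n) R
    (η := ENNReal.ofReal (unitBallVolume n)) (by simpa using unitBallVolume_pos)
  refine ⟨t, ht, fun K hK hV hR u => ?_⟩
  by_contra! hlt
  have hsub : (K : Set (E n)) ⊆ {x : E n | ‖x‖ ≤ R ∧ |⟪x, (u : E n)⟫| ≤ t} := by
    intro x hx
    refine ⟨norm_le_of_supportFn_le hR0.le hR hx, ?_⟩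
    have h1 := inner_le_supportFn K u hx
    have h2 := inner_le_supportFn K u (hK.2 x hx)
    rw [inner_neg_left] at h2
    rw [abs_le]
    constructor <;> linarith
  have h1 := (measure_mono hsub).trans_lt (hslab u)
  rw [← hV, bodyVolume, ofReal_measureReal K.isCompact.measure_lt_top.ne] at h1
  exact lt_irrefl _ h1

/-- The support function of a body with an entropy point at the origin and with an inscribed ball
of radius `ρ` has a uniformly integrable negative power. -/
theorem exists_integral_supportFn_rpow_le [NeZero n] {φ : S n → ℝ} (hφ : Continuous φ)
    (hφ0 : ∀ u, 0 < φ u) {p R ρ : ℝ} (hp : p < 1) (hR0 : 0 < R) (hρ : 0 < ρ) :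
    ∃ C > 0, ∀ K : ConvexBody (E n), IsEntropyPoint φ p K 0 → (∀ u, supportFn K u ≤ R) →
      ∀ c : E n, (∀ u : S n, ⟪c, (u : E n)⟫ + ρ ≤ supportFn K u) →
      ∫ u, supportFn K u ^ (p - 1) / φ u ∂(sphereMeasure n) ≤ C := by
  set D := (ρ / 2 + R) * (ρ / 2) ^ (p - 1)
  have hD : 0 < D := by positivity
  set Φ := ∫ u, 1 / φ u ∂(sphereMeasure n) with hΦdef
  have hΦ : 0 ≤ Φ := integral_nonneg fun u => (one_div_pos.2 (hφ0 u)).le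
  refine ⟨D * Φ / (ρ / 2) + 1, by positivity, fun K hE hR c hc => ?_⟩
  have hpos := supportFn_pos hE.1
  have hcont := (continuous_supportFn K).rpow_const (p := p - 1) fun u => Or.inl (hpos u).ne'
  have hi : Continuous fun u : S n => ⟪c, (u : E n)⟫ := by fun_prop
  have hi1 := hcont.div_weight hφ hφ0
  have hi2 : Integrable (fun u : S n => ⟪c, (u : E n)⟫ * (supportFn K u ^ (p - 1) / φ u))
      (sphereMeasure n) :=
    (hi.mul (hcont.div hφ fun u => (hφ0 u).ne')).integrable_sphereMeasure
  have hi3 : Integrable (fun u => 1 / φ u) (sphereMeasure n) :=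
    continuous_const.div_weight hφ hφ0
  -- From `c · u + ρ ≤ h` one gets `(ρ/2) h^(p-1) ≤ (h - ρ/2) h^(p-1) - (c · u) h^(p-1)`. The first
  -- term on the right is negative where `h < ρ/2` and so at most `D` everywhere; the second
  -- integrates to zero.
  have hpt : ∀ u : S n, ρ / 2 * (supportFn K u ^ (p - 1) / φ u) ≤
      D * (1 / φ u) - ⟪c, (u : E n)⟫ * (supportFn K u ^ (p - 1) / φ u) := by
    intro u
    have hq := Real.rpow_pos_of_pos (hpos u) (p - 1)
    have h1 : (supportFn K u - ρ / 2) * supportFn K u ^ (p - 1) ≤ D := by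
      rcases le_total (supportFn K u) (ρ / 2) with h | h
      · exact (mul_nonpos_of_nonpos_of_nonneg (by linarith) hq.le).trans hD.le
      · exact mul_le_mul (by linarith [hR u])
          (Real.rpow_le_rpow_of_nonpos (by positivity) h (by linarith)) hq.le (by positivity)
    have h2 := mul_le_mul_of_nonneg_right (hc u) hq.le
    have h3 : ρ / 2 * supportFn K u ^ (p - 1) ≤
        D - ⟪c, (u : E n)⟫ * supportFn K u ^ (p - 1) := by linarith
    have h4 := div_le_div_of_nonneg_right h3 (hφ0 u).le
    calc _ = _ := by ring
      _ ≤ _ := h4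
      _ = _ := by ring
  have h1 := integral_mono (hi1.const_mul (ρ / 2)) ((hi3.const_mul D).sub hi2) hpt
  rw [integral_sub' (hi3.const_mul D) hi2, integral_const_mul, integral_const_mul,
    hE.integral_inner_mul hφ hφ0 c, sub_zero, ← hΦdef] at h1
  have h2 : ∫ u, supportFn K u ^ (p - 1) / φ u ∂(sphereMeasure n) ≤ D * Φ / (ρ / 2) := by
    rw [le_div_iff₀ (by positivity)]
    linarith
  linarith

/-- If `h_K(v) = t ≤ 1`, then `h_K ≤ t (1 + R)` on the cap of radius `t`, which has measure of order
at least `t ^ (n - 1)`. The integral is thus at least of order `t ^ (n - 1 + q) ≥ 1 / t`. -/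
theorem exists_le_supportFn_of_integral_rpow_le [NeZero n] {φ : S n → ℝ} (hφ : Continuous φ)
    (hφ0 : ∀ u, 0 < φ u) {q R C : ℝ} (hq : q ≤ -(n : ℝ)) (hR0 : 0 < R) (hC : 0 < C) :
    ∃ r > 0, ∀ K : ConvexBody (E n), (0 : E n) ∈ interior (K : Set (E n)) →
      (∀ u, supportFn K u ≤ R) → ∫ u, supportFn K u ^ q / φ u ∂(sphereMeasure n) ≤ C →
      ∀ u, r ≤ supportFn K u := by
  obtain ⟨m, hm, _, _, hmφ⟩ := exists_one_div_bounds hφ hφ0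
  have hω := unitBallVolume_pos (n := n)
  have hn : (0 : ℝ) < n := Nat.cast_pos.2 (NeZero.pos n)
  set s := 2 * (1 / 4) ^ n * unitBallVolume n * (m * (1 + R) ^ q)
  have hs : 0 < s := by positivity
  refine ⟨min 1 (s / C), by positivity, fun K h0 hR hle v => ?_⟩
  have hpos := supportFn_pos h0
  set t := supportFn K v
  have ht : 0 < t := hpos v
  rcases le_total 1 t with h1t | ht1
  · exact (min_le_left _ _).trans h1t
  refine (min_le_right _ _).trans ?_
  rw [div_le_iff₀ hC]
  have hnorm : ∀ x ∈ K, ‖x‖ ≤ R := fun x hx => norm_le_of_supportFn_le hR0.le hR hx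
  have hpt : ∀ u, (ball v t).indicator (fun _ => (t * (1 + R)) ^ q * m) u ≤
      supportFn K u ^ q / φ u := by
    intro u
    by_cases hu : u ∈ ball v t
    · rw [indicator_of_mem hu, div_eq_mul_one_div (supportFn K u ^ q)]
      have h1 := supportFn_le_add_mul_norm hnorm u v
      rw [mem_ball, Subtype.dist_eq, dist_eq_norm] at hu
      have h2 : supportFn K u ≤ t * (1 + R) := by nlinarith
      exact mul_le_mul (Real.rpow_le_rpow_of_nonpos (hpos u) h2 (by linarith)) (hmφ u).1 hm.le
        (Real.rpow_nonneg (hpos u).le _)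
    · rw [indicator_of_notMem hu]
      exact div_nonneg (Real.rpow_nonneg (hpos u).le _) (hφ0 u).le
  have h2 := integral_mono ((integrable_const _).indicator measurableSet_ball)
    (((continuous_supportFn K).rpow_const
      fun u => Or.inl (hpos u).ne').div_weight hφ hφ0) hpt
  rw [integral_indicator_const _ measurableSet_ball, smul_eq_mul] at h2
  have h3 := le_sphereMeasure_ball v ht ht1
  have h4 : 1 ≤ t ^ n * t ^ q := by
    rw [← Real.rpow_natCast, ← Real.rpow_add ht]
    exact Real.one_le_rpow_of_pos_of_le_one_of_nonpos ht ht1 (by linarith)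
  calc s = s * 1 := (mul_one _).symm
    _ ≤ s * (t ^ n * t ^ q) := by gcongr
    _ = 2 * (t / 4) ^ n * unitBallVolume n * ((t * (1 + R)) ^ q * m) := by
      rw [Real.mul_rpow ht.le (by positivity)]
      simp only [s, div_pow]
      ring
    _ ≤ t * (sphereMeasure n).real (ball v t) * ((t * (1 + R)) ^ q * m) := by gcongr
    _ = t * ((sphereMeasure n).real (ball v t) * ((t * (1 + R)) ^ q * m)) := by ring
    _ ≤ t * C := by gcongr; exact h2.trans hle

/-- The reflection of the sphere that maps `v` to `-v`. -/
noncomputable def sphereReflection (v : S n) : S n → S n :=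
  LinearIsometryEquiv.sphereMap (Submodule.reflection (ℝ ∙ (v : E n))ᗮ)

theorem sphereReflection_coe (v u : S n) :
    (sphereReflection v u : E n) = u - (2 * ⟪(v : E n), (u : E n)⟫) • (v : E n) := by
  change Submodule.reflection (ℝ ∙ (v : E n))ᗮ (u : E n) = _
  rw [Submodule.reflection_orthogonal_apply, Submodule.reflection_singleton_apply,
    norm_sphere_coe]
  simp
  module

theorem inner_sphereReflection (v u : S n) :
    ⟪(v : E n), (sphereReflection v u : E n)⟫ = -⟪(v : E n), (u : E n)⟫ := by
  rw [sphereReflection_coe, inner_sub_right, real_inner_smul_right, real_inner_self_eq_norm_sq,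
    norm_sphere_coe]
  ring

theorem sphereReflection_sphereReflection (v u : S n) :
    sphereReflection v (sphereReflection v u) = u := by
  ext1
  rw [sphereReflection_coe, inner_sphereReflection, sphereReflection_coe]
  module

theorem continuous_sphereReflection (v : S n) : Continuous (sphereReflection v) :=
  LinearIsometryEquiv.continuous_sphereMap _

theorem supportFn_le_sphereReflection (K : ConvexBody (E n)) {v u : S n}
    (h : 0 ≤ ⟪(v : E n), (u : E n)⟫) :
    supportFn K u ≤ supportFn K (sphereReflection v u) +
      2 * ⟪(v : E n), (u : E n)⟫ * supportFn K v := by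
  refine supportFn_le K u fun x hx => ?_
  have h1 := inner_le_supportFn K (sphereReflection v u) hx
  have h2 := mul_le_mul_of_nonneg_left (inner_le_supportFn K v hx) h
  rw [sphereReflection_coe, inner_sub_right, real_inner_smul_right] at h1
  linarith

theorem inner_sphere_le_one (v u : S n) : ⟪(v : E n), (u : E n)⟫ ≤ 1 := by
  have := real_inner_le_norm (v : E n) (u : E n)
  rwa [norm_sphere_coe, norm_sphere_coe, one_mul] at this

/-- Add the moment in direction `v` to its image under the reflection. The constant weight matters
here, because it is invariant under every reflection. -/
theorem IsEntropyPoint.integral_reflection_eq_zero {p : ℝ} {K : ConvexBody (E n)}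
    (h : IsEntropyPoint (fun _ => 1) p K 0) (v : S n) :
    ∫ u : S n, ⟪(v : E n), (u : E n)⟫ * (supportFn K u ^ (p - 1) -
      supportFn K (sphereReflection v u) ^ (p - 1)) ∂(sphereMeasure n) = 0 := by
  have h1 := h.integral_inner_mul continuous_const (fun _ => one_pos) (v : E n)
  simp only [div_one] at h1
  have hc : Continuous fun u : S n => ⟪(v : E n), (u : E n)⟫ * supportFn K u ^ (p - 1) :=
    Continuous.mul (by fun_prop)
      ((continuous_supportFn K).rpow_const fun u => Or.inl (supportFn_pos h.1 u).ne')
  have hc' := hc.comp (continuous_sphereReflection v)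
  have h2 : ∫ u, ((fun u : S n => ⟪(v : E n), (u : E n)⟫ * supportFn K u ^ (p - 1)) ∘
      sphereReflection v) u ∂(sphereMeasure n) = 0 :=
    (LinearIsometryEquiv.integral_sphereMap (Submodule.reflection (ℝ ∙ (v : E n))ᗮ) hc).trans h1
  have h3 := integral_add hc.integrable_sphereMeasure hc'.integrable_sphereMeasure
  rw [h1, h2, add_zero] at h3
  rw [← h3]
  congr 1
  ext u
  simp only [Function.comp_apply, inner_sphereReflection]
  ring

theorem continuous_reflection_difference {q : ℝ} {K : ConvexBody (E n)}
    (h0 : (0 : E n) ∈ interior (K : Set (E n))) (v : S n) :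
    Continuous fun u : S n => ⟪(v : E n), (u : E n)⟫ * (supportFn K u ^ q -
      supportFn K (sphereReflection v u) ^ q) := by
  have hc := (continuous_supportFn K).rpow_const (p := q) fun u => Or.inl (supportFn_pos h0 u).ne'
  exact Continuous.mul (by fun_prop) (hc.sub (hc.comp (continuous_sphereReflection v)))

/-- The inball gives `h_K(v) + h_K(-v) ≥ 2ρ`, so thinness at `v` makes `h_K(-v)` large; the
Lipschitz bound spreads both facts over caps. -/
theorem supportFn_cap_bounds {K : ConvexBody (E n)} {R ρ δ : ℝ}
    (hR : ∀ x ∈ K, ‖x‖ ≤ R) (hR0 : 0 < R) {c : E n}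
    (hc : ∀ u : S n, ⟪c, (u : E n)⟫ + ρ ≤ supportFn K u) {v u : S n}
    (hv : supportFn K v ≤ ρ / 8) (hρ : 0 < ρ) (hδ : R * δ ≤ ρ / 8) (hu : u ∈ ball v δ) :
    supportFn K u ≤ ρ / 4 ∧ ρ / 2 ≤ supportFn K (sphereReflection v u) := by
  rw [mem_ball, Subtype.dist_eq, dist_eq_norm] at hu
  have h0 : R * ‖(u : E n) - v‖ ≤ ρ / 8 := (mul_le_mul_of_nonneg_left hu.le hR0.le).trans hδ
  have h1 := supportFn_le_add_mul_norm hR u v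
  have h2 := supportFn_le_add_mul_norm hR (-v) (sphereReflection v u)
  have h3 : ‖((-v : S n) : E n) - sphereReflection v u‖ = ‖(u : E n) - v‖ := by
    have h4 : sphereReflection v v = -v := by
      ext1
      rw [sphereReflection_coe, real_inner_self_eq_norm_sq, norm_sphere_coe]
      simp
      module
    rw [← h4]
    change ‖Submodule.reflection (ℝ ∙ (v : E n))ᗮ (v : E n) -
      Submodule.reflection (ℝ ∙ (v : E n))ᗮ (u : E n)‖ = _
    rw [← map_sub, LinearIsometryEquiv.norm_map, norm_sub_rev]
  have h4 := hc v
  have h5 := hc (-v)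
  have h6 : ⟪c, ((-v : S n) : E n)⟫ = -⟪c, (v : E n)⟫ := by simp
  rw [h3] at h2
  constructor <;> linarith

theorem exists_modulus_rpow {q R η : ℝ} (hq : 0 < q) (hη : 0 < η) :
    ∃ t > 0, ∀ s, 0 ≤ s → s ≤ R → (s + t) ^ q ≤ s ^ q + η := by
  have hc : UniformContinuousOn (fun x : ℝ => x ^ q) (Icc 0 (R + 1)) :=
    isCompact_Icc.uniformContinuousOn_of_continuous
      (continuousOn_id.rpow_const fun _ _ => Or.inr hq.le)
  obtain ⟨d, hd, h⟩ := Metric.uniformContinuousOn_iff.1 hc η hη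
  refine ⟨min 1 (d / 2), by positivity, fun s hs hsR => ?_⟩
  have h1 := min_le_left 1 (d / 2)
  have h2 := min_le_right 1 (d / 2)
  have h3 : 0 < min 1 (d / 2) := by positivity
  have h4 := h (s + min 1 (d / 2)) ⟨by linarith, by linarith⟩ s ⟨hs, by linarith⟩ (by
    rw [Real.dist_eq, add_sub_cancel_left, abs_of_pos h3]; linarith)
  rw [Real.dist_eq] at h4
  linarith [(abs_lt.1 h4).2]

/-- If `h_K(v)` is tiny, `h_K(u)` hardly exceeds its mirror value on the hemisphere of `v`, so the
reflected integrand is at most `η` everywhere, yet at most about `-g` on a cap around `v`. Its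
integral is then negative and not zero. -/
theorem exists_le_supportFn_of_one_lt [NeZero n] {p R ρ : ℝ} (hp : 1 < p) (hR0 : 0 < R)
    (hρ : 0 < ρ) :
    ∃ r > 0, ∀ K : ConvexBody (E n), IsEntropyPoint (fun _ => 1) p K 0 →
      (∀ u, supportFn K u ≤ R) →
      ∀ c : E n, (∀ u : S n, ⟪c, (u : E n)⟫ + ρ ≤ supportFn K u) → ∀ u, r ≤ supportFn K u := by
  have hq : 0 < p - 1 := by linarith
  set δ := min (1 / 2) (ρ / (8 * R))
  have hδ : 0 < δ := by positivity
  have hδR : R * δ ≤ ρ / 8 := by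
    calc R * δ ≤ R * (ρ / (8 * R)) := by gcongr; exact min_le_right _ _
      _ = ρ / 8 := by field_simp
  obtain ⟨κ, hκ, hball⟩ := exists_le_sphereMeasure_ball (n := n) hδ
  set g := 1 / 2 * ((ρ / 2) ^ (p - 1) - (ρ / 4) ^ (p - 1))
  have hg : 0 < g := by
    have := Real.rpow_lt_rpow (by positivity) (show ρ / 4 < ρ / 2 by linarith) hq
    simp only [g]
    linarith
  set σ := sphereMeasure n
  have hσ : 0 ≤ σ.real univ := measureReal_nonneg
  obtain ⟨t, ht, hmod⟩ := exists_modulus_rpow (R := R) hq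
    (η := g * κ / (2 * (σ.real univ + 1))) (by positivity)
  set η := g * κ / (2 * (σ.real univ + 1))
  have hη : 0 < η := by positivity
  refine ⟨min (ρ / 8) (t / 2), by positivity, fun K hE hR c hc v => ?_⟩
  by_contra! hlt
  have hv1 : supportFn K v ≤ ρ / 8 := hlt.le.trans (min_le_left _ _)
  have hv2 : supportFn K v ≤ t / 2 := hlt.le.trans (min_le_right _ _)
  have hpos := supportFn_pos hE.1
  have hnorm : ∀ x ∈ K, ‖x‖ ≤ R := fun x hx => norm_le_of_supportFn_le hR0.le hR hx
  have hhalf : ∀ u : S n, 0 ≤ ⟪(v : E n), (u : E n)⟫ →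
      ⟪(v : E n), (u : E n)⟫ * (supportFn K u ^ (p - 1) -
        supportFn K (sphereReflection v u) ^ (p - 1)) ≤ η := by
    intro u hu
    have hu1 := inner_sphere_le_one v u
    have h1 : supportFn K u ≤ supportFn K (sphereReflection v u) + t := by
      have h2 := supportFn_le_sphereReflection K hu
      have h3 := mul_le_mul hu1 hv2 (hpos v).le zero_le_one
      linarith
    have h2 := (Real.rpow_le_rpow (hpos u).le h1 hq.le).trans
      (hmod _ (hpos (sphereReflection v u)).le (hR _))
    calc _ ≤ ⟪(v : E n), (u : E n)⟫ * η := by gcongr; linarith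
      _ ≤ 1 * η := by gcongr
      _ = η := one_mul _
  have hpt : ∀ u : S n, ⟪(v : E n), (u : E n)⟫ * (supportFn K u ^ (p - 1) -
      supportFn K (sphereReflection v u) ^ (p - 1)) ≤
      η - (ball v δ).indicator (fun _ => g) u := by
    intro u
    by_cases hu : u ∈ ball v δ
    · rw [indicator_of_mem hu]
      obtain ⟨h1, h2⟩ := supportFn_cap_bounds hnorm hR0 hc hv1 hρ hδR hu
      have h3 := half_le_inner_of_dist_lt_one
        ((mem_ball.1 hu).trans_le ((min_le_left _ _).trans (by norm_num)))
      have h4 := Real.rpow_le_rpow (hpos u).le h1 hq.le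
      have h5 := Real.rpow_le_rpow (by positivity) h2 hq.le
      have h6 := mul_le_mul h3 (show (ρ / 2) ^ (p - 1) - (ρ / 4) ^ (p - 1) ≤
        supportFn K (sphereReflection v u) ^ (p - 1) - supportFn K u ^ (p - 1) by linarith)
        (by have : 0 < 1 / 2 * ((ρ / 2) ^ (p - 1) - (ρ / 4) ^ (p - 1)) := hg
            linarith) (by linarith)
      change g ≤ _ at h6
      linarith
    · rw [indicator_of_notMem hu, sub_zero]
      rcases le_total 0 ⟪(v : E n), (u : E n)⟫ with h | h
      · exact hhalf u h
      -- On the other hemisphere: the integrand is unchanged by the reflection, since both factors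
      -- change sign.
      · have := hhalf (sphereReflection v u) (by rw [inner_sphereReflection]; linarith)
        rw [inner_sphereReflection, sphereReflection_sphereReflection] at this
        linarith
  have hi : Integrable ((ball v δ).indicator fun _ => g) σ :=
    (integrable_const _).indicator measurableSet_ball
  have h1 := integral_mono (continuous_reflection_difference hE.1 v).integrable_sphereMeasure
    ((integrable_const η).sub hi) hpt
  rw [hE.integral_reflection_eq_zero v, integral_sub' (integrable_const η) hi, integral_const,
    integral_indicator_const _ measurableSet_ball, smul_eq_mul, smul_eq_mul] at h1
  have h2 := mul_le_mul_of_nonneg_right (hball v) hg.le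
  have h3 : (σ.real univ + 1) * η = g * κ / 2 := by simp only [η]; field_simp
  have h4 : 0 < g * κ := by positivity
  linarith

end LowerBound

/-! ### The range `p < 1` with constant weight: separated scales -/

section Scales
variable {n : ℕ}

/-- Either the origin is at distance at least of the order `ε` from the boundary, or there is a
direction `v` in which the body is `ε`-thin at the origin, while it is not thin in the directions
of the opposite hemisphere. -/
theorem le_supportFn_or_exists_direction {K : ConvexBody (E n)} {R ρ ε : ℝ} (h0 : (0 : E n) ∈ K)
    (hR : ∀ x ∈ K, ‖x‖ ≤ R) {c : E n} (hcK : c ∈ K)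
    (hc : ∀ u : S n, ⟪c, (u : E n)⟫ + ρ ≤ supportFn K u) (hε : 0 < ε) (hε1 : ε ≤ 1) :
    (∀ u, ε * (ρ / 2) ≤ supportFn K u) ∨ ∃ v : S n, supportFn K v ≤ ε * R ∧
      ∀ u : S n, ⟪(v : E n), (u : E n)⟫ ≤ 0 → ε * (ρ / 2) ≤ supportFn K u := by
  have hpos : ∀ u : S n, 0 ≤ supportFn K u := fun u => by
    simpa using inner_le_supportFn K u h0
  have hconcl : ∀ u : S n, -ε * ⟪c, (u : E n)⟫ ≤ supportFn K u →
      ε * (ρ / 2) ≤ supportFn K u := by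
    intro u hu
    have h1 := mul_le_mul_of_nonneg_left (hc u) hε.le
    have h2 := mul_le_mul_of_nonneg_right hε1 (hpos u)
    linarith
  -- The point `y` of `K` nearest to `-ε c`. If it is `-ε c` itself, every `h_K(u)` is at least `-ε
  -- c · u`, which suffices by `hconcl`. Otherwise the outer normal at `y` serves as `v`: `h_K(v) =
  -- y · v` is at most `‖y‖ ≤ ε ‖c‖`, and for `v · u ≤ 0` one has `-ε c · u ≤ y · u ≤ h_K(u)`.
  obtain ⟨y, hyK, hy⟩ := exists_norm_eq_iInf_of_complete_convex K.nonempty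
    K.isClosed.isComplete K.convex (-ε • c)
  rw [norm_eq_iInf_iff_real_inner_le_zero K.convex hyK] at hy
  by_cases hz : -ε • c - y = 0
  · left
    intro u
    apply hconcl
    rw [← real_inner_smul_left, sub_eq_zero.1 hz]
    exact inner_le_supportFn K u hyK
  right
  refine ⟨direction _ hz, ?_, fun u hu => ?_⟩
  · have h1 := hy 0 h0
    have h2 : ‖y‖ ^ 2 ≤ ⟪-ε • c, y⟫ := by
      rw [zero_sub, inner_neg_right, inner_sub_left, real_inner_self_eq_norm_sq] at h1
      linarith
    have h3 := real_inner_le_norm (-ε • c) y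
    have h4 : ‖-ε • c‖ = ε * ‖c‖ := by rw [norm_smul, norm_neg, Real.norm_of_nonneg hε.le]
    have h5 : ‖y‖ ≤ ε * R := by
      have h6 : ‖y‖ ≤ ε * ‖c‖ := by
        rw [h4] at h3
        by_contra! hlt
        nlinarith [norm_nonneg y, mul_nonneg hε.le (norm_nonneg c)]
      exact h6.trans (mul_le_mul_of_nonneg_left (hR c hcK) hε.le)
    refine le_trans (supportFn_le K _ fun x hx => ?_) h5
    have h6 := hy x hx
    have h7 : ⟪x - y, (direction _ hz : E n)⟫ ≤ 0 := by
      rw [real_inner_comm]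
      simp only [direction, real_inner_smul_left]
      exact mul_nonpos_of_nonneg_of_nonpos (by positivity) h6
    have h8 := real_inner_le_norm y (direction _ hz : E n)
    rw [norm_sphere_coe, mul_one] at h8
    rw [inner_sub_left] at h7
    linarith
  · apply hconcl
    have h1 := inner_le_supportFn K u hyK
    simp only [direction, real_inner_smul_left] at hu
    have h2 := nonpos_of_mul_nonpos_right hu (inv_pos.2 (norm_pos_iff.2 hz))
    rw [inner_sub_left, real_inner_smul_left] at h2
    linarith

theorem exists_ratio_rpow {q R η b : ℝ} (hη : 0 < η) :
    ∃ Λ > 0, b < Λ ∧ 1 - η ≤ (1 + 2 * R / Λ) ^ q := by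
  have h1 : Filter.Tendsto (fun Λ : ℝ => 1 + 2 * R / Λ) Filter.atTop (nhds 1) := by
    simpa using (Filter.Tendsto.const_div_atTop Filter.tendsto_id (2 * R)).const_add 1
  have h2 := h1.rpow_const (p := q) (Or.inl one_ne_zero)
  rw [Real.one_rpow] at h2
  obtain ⟨Λ, h3, h4, h5⟩ := ((h2.eventually (lt_mem_nhds (show 1 - η < 1 by linarith))).and
    ((Filter.eventually_gt_atTop 0).and (Filter.eventually_gt_atTop b))).exists
  exact ⟨Λ, h4, h5, h3.le⟩

/-- If the body is thin in the direction `v`, but not in the opposite hemisphere, then a definite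
part of the integral of `h_K ^ (p - 1)` comes from directions in which `h_K` is of the order `ε`. -/
theorem le_setIntegral_of_thin {p R ρ δ g κ η Λ C ε : ℝ} (hp : p < 1) (hR0 : 0 < R) (hρ : 0 < ρ)
    (hδ1 : δ ≤ 1) (hδR : R * δ ≤ ρ / 8)
    (hg : g = 1 / 2 * ((ρ / 4) ^ (p - 1) - (ρ / 2) ^ (p - 1)))
    (hΛ : 0 < Λ) (hη : 0 < η) (hηΛ : 1 - η ≤ (1 + 2 * R / Λ) ^ (p - 1))
    {K : ConvexBody (E n)} (hE : IsEntropyPoint (fun _ => 1) p K 0)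
    (hR : ∀ x ∈ K, ‖x‖ ≤ R) {c : E n}
    (hc : ∀ u : S n, ⟪c, (u : E n)⟫ + ρ ≤ supportFn K u)
    (hC : ∫ u, supportFn K u ^ (p - 1) ∂(sphereMeasure n) ≤ C) (hηC : η * C ≤ g * κ / 4)
    (hεR : ε * R ≤ ρ / 8) {v : S n}
    (hκ : κ ≤ (sphereMeasure n).real (ball v δ)) (hv : supportFn K v ≤ ε * R)
    (hthick : ∀ u : S n, ⟪(v : E n), (u : E n)⟫ ≤ 0 → ε * (ρ / 2) ≤ supportFn K u) :
    g * κ / 4 ≤ ∫ u in {u | supportFn K u ∈ Icc (ε * (ρ / 2)) (ε * Λ)},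
      supportFn K u ^ (p - 1) ∂(sphereMeasure n) := by
  have hq : p - 1 < 0 := by linarith
  set q := p - 1
  set σ := sphereMeasure n
  have hpos := supportFn_pos hE.1
  have hg0 : 0 < g := by
    have := Real.rpow_lt_rpow_of_neg (by positivity) (show ρ / 4 < ρ / 2 by linarith) hq
    rw [hg]
    linarith
  set A : Set (S n) := {u | supportFn K u ∈ Icc (ε * (ρ / 2)) (ε * Λ)}
  have hA : MeasurableSet A := (continuous_supportFn K).measurable measurableSet_Icc
  -- A majorant for the compensation at a mirror point with value `s` there: at most `s ^ q` if `s ≤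
  -- ε Λ`, and at most `η s ^ q` if `s > ε Λ`, because then `h_K(u)` exceeds `s` at most by the
  -- factor `1 + 2R/Λ`.
  let G : S n → ℝ := fun u => A.indicator (fun u => supportFn K u ^ q) u + η * supportFn K u ^ q
  have hcont : Continuous fun u => supportFn K u ^ q :=
    (continuous_supportFn K).rpow_const fun u => Or.inl (hpos u).ne'
  have hhq : ∀ u, 0 < supportFn K u ^ q := fun u => Real.rpow_pos_of_pos (hpos u) _
  have hiA : Integrable (A.indicator fun u => supportFn K u ^ q) σ :=
    hcont.integrable_sphereMeasure.indicator hA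
  have hiη : Integrable (fun u => η * supportFn K u ^ q) σ :=
    (hcont.const_mul η).integrable_sphereMeasure
  have hiG : Integrable G σ := hiA.add hiη
  have hG0 : ∀ u, 0 ≤ G u := fun u =>
    add_nonneg (indicator_nonneg (fun u _ => (hhq u).le) u) (mul_nonneg hη.le (hhq u).le)
  have hhalf : ∀ u : S n, 0 ≤ ⟪(v : E n), (u : E n)⟫ →
      -G (sphereReflection v u) ≤ ⟪(v : E n), (u : E n)⟫ * (supportFn K u ^ q -
        supportFn K (sphereReflection v u) ^ q) := by
    intro u hu
    have hu1 := inner_sphere_le_one v u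
    set s := supportFn K (sphereReflection v u) with hs
    have hs0 : 0 < s := hpos _
    have hsq : 0 < s ^ q := hhq _
    have hthick' : ε * (ρ / 2) ≤ s := hthick _ (by rw [inner_sphereReflection]; linarith)
    have huq := hhq u
    by_cases hsΛ : s ≤ ε * Λ
    · have hmem : sphereReflection v u ∈ A := ⟨hthick', hsΛ⟩
      have h1 : s ^ q ≤ G (sphereReflection v u) := by
        simp only [G, indicator_of_mem hmem]
        have := mul_nonneg hη.le hsq.le
        linarith
      have h2 := mul_le_mul_of_nonneg_right hu1 hsq.le
      have h3 := mul_nonneg hu huq.le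
      linarith
    · have h1 : η * s ^ q ≤ G (sphereReflection v u) :=
        le_add_of_nonneg_left (indicator_nonneg (fun u _ => (hhq u).le) _)
      have h2 : supportFn K u ≤ s * (1 + 2 * R / Λ) := by
        have h3 := supportFn_le_sphereReflection K hu
        have h4 := mul_le_mul hu1 hv (hpos v).le zero_le_one
        have h5 : ε * R ≤ s * (R / Λ) := by
          rw [mul_div_assoc', le_div_iff₀ hΛ]
          nlinarith
        have h6 : s * (1 + 2 * R / Λ) = s + 2 * (s * (R / Λ)) := by ring
        linarith
      have h3 := Real.rpow_le_rpow_of_nonpos (hpos u) h2 hq.le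
      rw [Real.mul_rpow hs0.le (by positivity)] at h3
      have h4 : s ^ q - η * s ^ q ≤ supportFn K u ^ q := by
        have := mul_le_mul_of_nonneg_left hηΛ hsq.le
        linarith
      have h5 := mul_le_mul_of_nonneg_left
        (show -(η * s ^ q) ≤ supportFn K u ^ q - s ^ q by linarith) hu
      have h6 := mul_le_mul_of_nonneg_right hu1 (mul_nonneg hη.le hsq.le)
      linarith
  have hpt : ∀ u : S n, (ball v δ).indicator (fun _ => g) u -
      (G u + G (sphereReflection v u)) ≤ ⟪(v : E n), (u : E n)⟫ * (supportFn K u ^ q -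
        supportFn K (sphereReflection v u) ^ q) := by
    intro u
    have hG1 := hG0 u
    have hG2 := hG0 (sphereReflection v u)
    by_cases hu : u ∈ ball v δ
    · rw [indicator_of_mem hu]
      obtain ⟨h1, h2⟩ := supportFn_cap_bounds hR hR0 hc (hv.trans hεR) hρ hδR hu
      have h3 := half_le_inner_of_dist_lt_one ((mem_ball.1 hu).trans_le hδ1)
      have h4 := Real.rpow_le_rpow_of_nonpos (hpos u) h1 hq.le
      have h5 := Real.rpow_le_rpow_of_nonpos (by positivity) h2 hq.le
      have h6 := mul_le_mul h3 (show (ρ / 4) ^ q - (ρ / 2) ^ q ≤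
        supportFn K u ^ q - supportFn K (sphereReflection v u) ^ q by linarith)
        (by linarith) (by linarith)
      linarith
    · rw [indicator_of_notMem hu]
      rcases le_total 0 ⟪(v : E n), (u : E n)⟫ with h | h
      · have := hhalf u h
        linarith
      · have := hhalf (sphereReflection v u) (by rw [inner_sphereReflection]; linarith)
        rw [inner_sphereReflection, sphereReflection_sphereReflection] at this
        linarith
  have hmp : MeasurePreserving (sphereReflection v) σ σ :=
    LinearIsometryEquiv.measurePreserving_sphereMap _
  have hiG' : Integrable (fun u => G (sphereReflection v u)) σ := hmp.integrable_comp_of_integrable hiG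
  have hintG' : ∫ u, G (sphereReflection v u) ∂σ = ∫ u, G u ∂σ := by
    have h1 := integral_map (μ := σ) hmp.measurable.aemeasurable (f := G)
      (by rw [hmp.map_eq]; exact hiG.aestronglyMeasurable)
    rw [hmp.map_eq] at h1
    exact h1.symm
  have hintG : ∫ u, G u ∂σ = ∫ u in A, supportFn K u ^ q ∂σ + η * ∫ u, supportFn K u ^ q ∂σ := by
    simp only [G]
    rw [integral_add hiA hiη, integral_indicator hA, integral_const_mul]
  have hi : Integrable ((ball v δ).indicator fun _ => g) σ :=
    (integrable_const _).indicator measurableSet_ball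
  have hiGG : Integrable (fun u => G u + G (sphereReflection v u)) σ := hiG.add hiG'
  have h1 := integral_mono (hi.sub hiGG)
    (continuous_reflection_difference hE.1 v).integrable_sphereMeasure hpt
  rw [hE.integral_reflection_eq_zero v, integral_sub' hi hiGG,
    integral_indicator_const _ measurableSet_ball, smul_eq_mul, integral_add hiG hiG', hintG',
    hintG] at h1
  have h2 := mul_le_mul_of_nonneg_right hκ hg0.le
  have h3 := mul_le_mul_of_nonneg_left hC hη.le
  linarith

/-- If the bound failed, the body would be thin at each of the scales `ε k`, `k < N`. Each scale
contributes at least `g κ / 4` to `∫ h_K ^ (p - 1)` on its own set of directions, in total more than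
the bound `C`. -/
theorem exists_le_supportFn_of_lt_one [NeZero n] {p R ρ : ℝ} (hp : p < 1) (hR0 : 0 < R)
    (hρ : 0 < ρ) :
    ∃ r > 0, ∀ K : ConvexBody (E n), IsEntropyPoint (fun _ => 1) p K 0 →
      (∀ u, supportFn K u ≤ R) →
      ∀ c ∈ K, (∀ u : S n, ⟪c, (u : E n)⟫ + ρ ≤ supportFn K u) → ∀ u, r ≤ supportFn K u := by
  have hq : p - 1 < 0 := by linarith
  obtain ⟨C, hC, hint⟩ := exists_integral_supportFn_rpow_le (n := n) (φ := fun _ => 1)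
    continuous_const (fun _ => one_pos) hp hR0 hρ
  simp only [div_one] at hint
  set δ := min 1 (ρ / (8 * R))
  have hδ : 0 < δ := by positivity
  have hδR : R * δ ≤ ρ / 8 := by
    calc R * δ ≤ R * (ρ / (8 * R)) := by gcongr; exact min_le_right _ _
      _ = ρ / 8 := by field_simp
  obtain ⟨κ, hκ, hball⟩ := exists_le_sphereMeasure_ball (n := n) hδ
  obtain ⟨g, hg⟩ : ∃ g, g = 1 / 2 * ((ρ / 4) ^ (p - 1) - (ρ / 2) ^ (p - 1)) := ⟨_, rfl⟩
  have hg0 : 0 < g := by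
    have := Real.rpow_lt_rpow_of_neg (by positivity) (show ρ / 4 < ρ / 2 by linarith) hq
    rw [hg]
    linarith
  obtain ⟨Λ, hΛ, hbΛ, hηΛ⟩ := exists_ratio_rpow (q := p - 1) (R := R) (η := g * κ / (4 * C))
    (b := ρ / 2) (by positivity)
  set η := g * κ / (4 * C)
  have hηC : η * C ≤ g * κ / 4 := le_of_eq (by simp only [η]; field_simp)
  -- This ratio separates the windows `[ε k ρ/2, ε k Λ]` of successive scales: the upper end of each
  -- is half the lower end of the one before.
  set θ := ρ / 2 / (2 * Λ)
  have hθ : 0 < θ := by positivity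
  have hθ1 : θ ≤ 1 := by
    simp only [θ]; rw [div_le_one (by positivity)]; linarith
  set ε : ℕ → ℝ := fun k => δ * θ ^ k
  have hε : ∀ k, 0 < ε k := fun k => by positivity
  have hεδ : ∀ k, ε k ≤ δ := fun k => mul_le_of_le_one_right hδ.le (pow_le_one₀ hθ.le hθ1)
  obtain ⟨N, hN⟩ := exists_nat_gt (C / (g * κ / 4))
  refine ⟨ε N * (ρ / 2), mul_pos (hε N) (by positivity), fun K hE hR c hcK hc => ?_⟩
  have hpos := supportFn_pos hE.1
  have hnorm : ∀ x ∈ K, ‖x‖ ≤ R := fun x hx => norm_le_of_supportFn_le hR0.le hR hx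
  by_contra hcon
  have hthin : ∀ k < N, ∃ v : S n, supportFn K v ≤ ε k * R ∧
      ∀ u : S n, ⟪(v : E n), (u : E n)⟫ ≤ 0 → ε k * (ρ / 2) ≤ supportFn K u := by
    intro k hk
    refine (le_supportFn_or_exists_direction (interior_subset hE.1) hnorm hcK hc (hε k)
      ((hεδ k).trans (min_le_left _ _))).resolve_left fun h => hcon fun u => le_trans ?_ (h u)
    have : θ ^ N ≤ θ ^ k := pow_le_pow_of_le_one hθ.le hθ1 hk.le
    simp only [ε]
    gcongr
  let A : ℕ → Set (S n) := fun k => {u | supportFn K u ∈ Icc (ε k * (ρ / 2)) (ε k * Λ)}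
  have hA : ∀ k, MeasurableSet (A k) := fun k =>
    (continuous_supportFn K).measurable measurableSet_Icc
  have hdisj : ∀ j k, j < k → Disjoint (A j) (A k) := by
    intro j k hjk
    rw [Set.disjoint_left]
    intro u hj hk
    have h1 : θ ^ k ≤ θ ^ j * θ := by
      rw [← pow_succ]
      exact pow_le_pow_of_le_one hθ.le hθ1 hjk
    have h2 : ε k * Λ ≤ ε j * (ρ / 2) / 2 := by
      calc ε k * Λ ≤ δ * (θ ^ j * θ) * Λ := by simp only [ε]; gcongr
        _ = ε j * (ρ / 2) / 2 := by simp only [ε, θ]; field_simp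
    have h3 := mul_pos (hε j) (show 0 < ρ / 2 by positivity)
    linarith [hj.1, hk.2]
  have hI := ((continuous_supportFn K).rpow_const (p := p - 1)
    fun u => Or.inl (hpos u).ne').integrable_sphereMeasure
  have hbig : ∀ k ∈ Finset.range N, g * κ / 4 ≤
      ∫ u in A k, supportFn K u ^ (p - 1) ∂(sphereMeasure n) := by
    intro k hk
    obtain ⟨v, hv, hthick⟩ := hthin k (Finset.mem_range.1 hk)
    have hεR : ε k * R ≤ ρ / 8 :=
      (mul_le_mul_of_nonneg_right (hεδ k) hR0.le).trans (by rwa [mul_comm])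
    exact le_setIntegral_of_thin hp hR0 hρ (min_le_left _ _) hδR hg hΛ (by positivity) hηΛ hE
      hnorm hc (hint K hE hR c hc) hηC hεR (hball v) hv hthick
  have h1 := Finset.sum_le_sum hbig
  rw [← integral_biUnion_finset _ (fun k _ => hA k) (fun j _ k _ hjk => by
      rcases lt_or_gt_of_ne hjk with h | h
      · exact hdisj j k h
      · exact (hdisj k j h).symm) (fun k _ => hI.integrableOn)] at h1
  have h2 := h1.trans (setIntegral_le_integral hI
    (ae_of_all _ fun u => Real.rpow_nonneg (hpos u).le _))
  rw [Finset.sum_const, Finset.card_range, nsmul_eq_mul] at h2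
  have h3 := h2.trans (hint K hE hR c hc)
  rw [div_lt_iff₀ (by positivity)] at hN
  exact absurd h3 (not_le.2 hN)

end Scales

/-! ### Assembly for the three classes -/

theorem uniformlyPinched_entropyClass (n : ℕ) [NeZero n] {p a : ℝ} (hpn : -(n : ℝ) < p)
    (hp1 : p ≠ 1) (ha : 0 < a) : UniformlyPinched (entropyClass n p a) := by
  have hone : ∀ _ : S n, (0 : ℝ) < 1 := fun _ => one_pos
  obtain ⟨R, hR0, hR⟩ : ∃ R > 0, ∀ K ∈ entropyClass n p a, ∀ u, supportFn K u ≤ R := by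
    rcases lt_or_ge 0 p with hp | hp
    · obtain ⟨R, hR0, hR⟩ := exists_supportFn_le_of_integral_rpow_le continuous_const hone hp ha
      exact ⟨R, hR0, fun K hK => hR K hK.2.2.1.1 (hK.2.2.2.1 hp)⟩
    · obtain ⟨R, hR0, hR⟩ := exists_supportFn_le_of_entropyPoint continuous_const hone hpn hp ha
      exact ⟨R, hR0, fun K hK => hR K hK.1 hK.2.1 hK.2.2.1 (fun _ => hK.2.2.2) hK.2.2.2.2.2⟩
  obtain ⟨ρ, hρ, hball⟩ := exists_inball (n := n) hR0
  obtain ⟨r, hr, hle⟩ : ∃ r > 0, ∀ K ∈ entropyClass n p a, ∀ u, r ≤ supportFn K u := by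
    rcases lt_or_gt_of_ne hp1 with hp | hp
    · obtain ⟨r, hr, hle⟩ := exists_le_supportFn_of_lt_one (n := n) hp hR0 hρ
      refine ⟨r, hr, fun K hK => ?_⟩
      obtain ⟨c, hcK, hc⟩ := hball K hK.1 hK.2.1 (hR K hK)
      exact hle K hK.2.2.1 (hR K hK) c hcK hc
    · obtain ⟨r, hr, hle⟩ := exists_le_supportFn_of_one_lt (n := n) hp hR0 hρ
      refine ⟨r, hr, fun K hK => ?_⟩
      obtain ⟨c, hcK, hc⟩ := hball K hK.1 hK.2.1 (hR K hK)
      exact hle K hK.2.2.1 (hR K hK) c hc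
  exact ⟨r, R, hr, hR0, fun K hK u => ⟨hle K hK u, hR K hK u⟩⟩

theorem uniformlyPinched_weightedEntropyClass (n : ℕ) [NeZero n] {φ : S n → ℝ}
    (hφ : φ ∈ positiveSmooth n) {p a : ℝ} (hpn : -(n : ℝ) < p) (hp : p ≤ -(n : ℝ) + 1)
    (ha : 0 < a) : UniformlyPinched (weightedEntropyClass n φ p a) := by
  have hφ0 := hφ.1
  have hφc : Continuous φ := hφ.2.continuous
  have hn1 : (1 : ℝ) ≤ n := Nat.one_le_cast.2 (NeZero.one_le)
  obtain ⟨R, hR0, hR⟩ : ∃ R > 0, ∀ K ∈ weightedEntropyClass n φ p a, ∀ u, supportFn K u ≤ R := by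
    rcases lt_or_ge p 0 with hp0 | hp0
    · obtain ⟨R, hR0, hR⟩ := exists_supportFn_le_of_entropyPoint hφc hφ0 hpn hp0.le ha
      exact ⟨R, hR0, fun K hK => hR K hK.1 hK.2.1 hK.2.2.1 (fun h => absurd h hp0.ne)
        fun _ => hK.2.2.2⟩
    -- Here `0 ≤ p ≤ 1 - n` leaves only dimension one.
    · have hn : n = 1 := le_antisymm (Nat.cast_le_one.1 (by linarith : (n : ℝ) ≤ 1)) NeZero.one_le
      subst hn
      exact ⟨2, two_pos, fun K hK => supportFn_le_two_of_dim_one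
        (interior_subset hK.2.2.1.1) hK.2.1⟩
  obtain ⟨ρ, hρ, hball⟩ := exists_inball (n := n) hR0
  obtain ⟨C, hC, hint⟩ := exists_integral_supportFn_rpow_le hφc hφ0 (p := p) (by linarith) hR0 hρ
  obtain ⟨r, hr, hle⟩ := exists_le_supportFn_of_integral_rpow_le hφc hφ0 (q := p - 1)
    (by linarith) hR0 hC
  refine ⟨r, R, hr, hR0, fun K hK u => ⟨?_, hR K hK u⟩⟩
  obtain ⟨c, -, hc⟩ := hball K hK.1 hK.2.1 (hR K hK)
  exact hle K hK.2.2.1.1 (hR K hK) (hint K hK.2.2.1 (hR K hK) c hc) u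

theorem uniformlyPinched_symmetricEntropyClass (n : ℕ) [NeZero n] {φ : S n → ℝ}
    (hφ : φ ∈ positiveSmooth n) {p a : ℝ} (hpn : -(n : ℝ) < p) (ha : 0 < a) :
    UniformlyPinched (symmetricEntropyClass n φ p a) := by
  have hφ0 := hφ.1
  have hφc : Continuous φ := hφ.2.continuous
  obtain ⟨R, hR0, hR⟩ : ∃ R > 0, ∀ K ∈ symmetricEntropyClass n φ p a, ∀ u,
      supportFn K u ≤ R := by
    rcases lt_or_ge 0 p with hp | hp
    · obtain ⟨R, hR0, hR⟩ := exists_supportFn_le_of_integral_rpow_le hφc hφ0 hp ha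
      exact ⟨R, hR0, fun K hK => hR K (zero_mem_interior_of_symmetric hK.1) (hK.2.2.1 hp)⟩
    · obtain ⟨R, hR0, hR⟩ := exists_supportFn_le_of_symmetric hφc hφ0 hpn hp ha
      exact ⟨R, hR0, fun K hK => hR K hK.1 hK.2.1 hK.2.2⟩
  obtain ⟨r, hr, hle⟩ := exists_le_supportFn_of_symmetric (n := n) hR0
  exact ⟨r, R, hr, hR0, fun K hK u => ⟨hle K hK.1 hK.2.1 (hR K hK) u, hR K hK u⟩⟩

theorem mainTheorem9 (n : ℕ) [NeZero n] :
    (∀ p a : ℝ, -(n : ℝ) < p → p ≠ 1 → 0 < a → UniformlyPinched (entropyClass n p a)) ∧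
    (∀ φ ∈ positiveSmooth n, ∀ p a : ℝ, -(n : ℝ) < p → p ≤ -(n : ℝ) + 1 → 0 < a →
      UniformlyPinched (weightedEntropyClass n φ p a)) ∧
    (∀ φ ∈ positiveSmoothEven n, ∀ p a : ℝ, -(n : ℝ) < p → 0 < a →
      UniformlyPinched (symmetricEntropyClass n φ p a)) :=
  ⟨fun _ _ hpn hp1 ha => uniformlyPinched_entropyClass n hpn hp1 ha,
    fun _ hφ _ _ hpn hp ha => uniformlyPinched_weightedEntropyClass n hφ hpn hp ha,
    fun _ hφ _ _ hpn ha => uniformlyPinched_symmetricEntropyClass n hφ.1 hpn ha⟩
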